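/- Let $f:\mathbb R\to\mathbb R$ be $M$-quasi-self-concordant, i.e. $M>0$, $f$ is three times continuously differentiable and $|f'''(t)|\le M f''(t)$ for all $t\in\mathbb R$ (in particular $f$ is convex). Let $A\in\mathbb R^{d\times n}$, $b\in\mathbb R^d$, $P\in\mathbb R^{m\times n}$ with $m\ge 1$, and write $F(x)=\sum_{i=1}^m f\big((Px)_i\big)$. Suppose that $R>0$ and that the problem $\min_{Ax=b}F(x)$ has an optimal solution $x^\star$ with $\|Px^\star\|_\infty\le R$. Let $x^{(0)}$ be a starting point with $Ax^{(0)}=b$ and $\|Px^{(0)}\|_\infty\le R$, and let $\epsilon>0$. **Theorem.** There are an algorithm and universal constants $C,k$ such that for all such data (of all dimensions), the algorithm, given $M$, $R$, $\epsilon$ and $x^{(0)}$, halts with a point $\tilde x$ satisfying $$A\tilde x=b,\qquad F(\tilde x)-F(x^\star)\le\epsilon ,$$ after at most $$C\,(1+MR)\;m^{1/3}\,\log(2+MR)\,\log\!\Big(2+\frac{F(x^{(0)})-F(x^\star)}{\epsilon}\Big)\,\log^{k}(2+m)\;=\;\widetilde O\!\Big(MR\,m^{1/3}\log(MR)\log\frac{F(x^{(0)})-F(x^\star)}{\epsilon}\Big)$$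 calls to a linear system solver, and at most as many other steps. (The last expression is read in the range $MR\ge2$, $F(x^{(0)})-F(x^\star)\ge2\epsilon$, with $\widetilde O$ hiding powers of $\log(2+m)$.) Here an algorithm is one finite program, independent of the instance and of its dimensions, with finitely many registers for scalars, for vectors in $\mathbb R^n$ and for vectors in $\mathbb R^m$, built from assignments, sequencing, if-then-else and while loops, whose tests are comparisons $\le$ of scalars, in exact real arithmetic. An assignment (one step) evaluates a fixed expression made of rational constants, coordinatewise $+,-,\times,/,\exp,\log$ and indicators of $\le$, constant vectors, sums of coordinates, coordinatewise evaluation of $f,f',f''$, and products of vectors with $P$ and $P^\top$; a test is one step. A call to the linear system solver takes $r\in\mathbb R^m$ and $c\in\mathbb R^n$ and returns the part $\Delta$ of a solution $(\Delta,\mu)$ of the system $P^\top\mathrm{diag}(r)P\Delta+A^\top\mu=c$, $A\Delta=0$. The solver is arbitrary: it returns some solution whenever the system is solvable, and any vector otherwise; the bounds hold for every such solver. -/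

import Mathlib

open scoped Matrix

namespace QSC

/-- `f` is `M`-quasi-self-concordant: three times continuously differentiable, with
`|f'''| ≤ M f''` everywhere (so `f'' ≥ 0`, that is, `f` is convex). -/
def IsQuasiSelfConcordant (f : ℝ → ℝ) (M : ℝ) : Prop :=
  0 < M ∧ ContDiff ℝ 3 f ∧ ∀ t, |iteratedDeriv 3 f t| ≤ M * iteratedDeriv 2 f t

/-- The data of the problem `min { ∑ i, f ((P x) i) : A x = b }`. -/
structure Problem (d n m : ℕ) where
  A : Matrix (Fin d) (Fin n) ℝ
  b : Fin d → ℝ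
  P : Matrix (Fin m) (Fin n) ℝ
  f : ℝ → ℝ

variable {d n m : ℕ}

/-- The objective `x ↦ ∑ i, f ((P x) i)`. -/
def Problem.objective (pb : Problem d n m) (x : Fin n → ℝ) : ℝ :=
  ∑ i, pb.f ((pb.P *ᵥ x) i)

/-- `x` minimizes the objective subject to `A x = b`. -/
def Problem.IsOptimal (pb : Problem d n m) (x : Fin n → ℝ) : Prop :=
  pb.A *ᵥ x = pb.b ∧ ∀ y, pb.A *ᵥ y = pb.b → pb.objective x ≤ pb.objective y

/-! ### Linear system solvers -/

/-- A map that takes a square linear system `K u = c` (with `n + d` unknowns) to a vector. -/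
abbrev SolverMap (d n : ℕ) : Type :=
  Matrix (Fin n ⊕ Fin d) (Fin n ⊕ Fin d) ℝ → (Fin n ⊕ Fin d → ℝ) → (Fin n ⊕ Fin d → ℝ)

/-- A linear system solver returns some solution of every solvable system; nothing is known about
what it returns for an unsolvable one, nor about which solution it returns. -/
def IsLinearSolver (S : SolverMap d n) : Prop :=
  ∀ K c, (∃ u, K *ᵥ u = c) → K *ᵥ S K c = c

/-- The matrix `[[Pᵀ diag(r) P, Aᵀ], [A, 0]]` of the optimality conditions of a weighted least
squares problem `min { ∑ i, r i * ((P Δ) i)² - 2 ⟨c, Δ⟩ : A Δ = 0 }`. -/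
noncomputable def Problem.kkt (pb : Problem d n m) (r : Fin m → ℝ) :
    Matrix (Fin n ⊕ Fin d) (Fin n ⊕ Fin d) ℝ :=
  Matrix.fromBlocks (pb.Pᵀ * Matrix.diagonal r * pb.P) pb.Aᵀ pb.A 0

/-- One call to the solver: the system `Pᵀ diag(r) P Δ + Aᵀ μ = c`, `A Δ = 0` is handed to `S`, and
the part `Δ` of the answer is kept. -/
noncomputable def Problem.solve (pb : Problem d n m) (S : SolverMap d n)
    (r : Fin m → ℝ) (c : Fin n → ℝ) : Fin n → ℝ :=
  fun j => S (pb.kkt r) (Sum.elim c 0) (Sum.inl j)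

/-! ### Programs

A program is a finite text that does not depend on the instance or on its dimensions. It works on
registers that hold scalars, vectors of `ℝⁿ` (`prim`) and vectors of `ℝᵐ` (`rows`), with exact real
arithmetic. It has access to `P` by products with `P` and `Pᵀ` only, to `f` by evaluations of
`f, f', f''` only, and to `A` by calls to the linear system solver only. -/

inductive Kind
  | scal
  | prim
  | rows
  deriving DecidableEq

/-- The length of the vectors of each kind; scalars are vectors of length one. -/
def Kind.dim (n m : ℕ) : Kind → ℕ
  | .scal => 1
  | .prim => n
  | .rows => m

/-- Expressions. The arithmetic operations act coordinatewise on all kinds. -/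
inductive Expr : Kind → Type
  | var (κ : Kind) (i : ℕ) : Expr κ
  | const (q : ℚ) : Expr .scal
  | add {κ : Kind} (a b : Expr κ) : Expr κ
  | sub {κ : Kind} (a b : Expr κ) : Expr κ
  | mul {κ : Kind} (a b : Expr κ) : Expr κ
  | div {κ : Kind} (a b : Expr κ) : Expr κ
  /-- coordinatewise `1` where `a ≤ b`, and `0` elsewhere -/
  | le {κ : Kind} (a b : Expr κ) : Expr κ
  | exp {κ : Kind} (a : Expr κ) : Expr κ
  | log {κ : Kind} (a : Expr κ) : Expr κ
  /-- the vector all of whose coordinates are the given scalar -/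
  | bcast (κ : Kind) (a : Expr .scal) : Expr κ
  /-- the sum of the coordinates -/
  | sum {κ : Kind} (a : Expr κ) : Expr .scal
  /-- coordinatewise `f`, `f'` or `f''` -/
  | loss (k : Fin 3) (a : Expr .rows) : Expr .rows
  | mulP (a : Expr .prim) : Expr .rows
  | mulPT (a : Expr .rows) : Expr .prim

/-- The contents of the registers. -/
abbrev Store (n m : ℕ) : Type := (κ : Kind) → ℕ → (Fin (κ.dim n m) → ℝ)

/-- The store `s` with the `i`-th register of kind `κ` overwritten by `v`. -/
def Store.set (s : Store n m) (κ : Kind) (i : ℕ) (v : Fin (κ.dim n m) → ℝ) : Store n m :=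
  Function.update s κ (Function.update (s κ) i v)

noncomputable def Expr.eval (pb : Problem d n m) (s : Store n m) :
    {κ : Kind} → Expr κ → (Fin (κ.dim n m) → ℝ)
  | _, .var κ i => s κ i
  | _, .const q => fun _ => (q : ℝ)
  | _, .add a b => fun j => a.eval pb s j + b.eval pb s j
  | _, .sub a b => fun j => a.eval pb s j - b.eval pb s j
  | _, .mul a b => fun j => a.eval pb s j * b.eval pb s j
  | _, .div a b => fun j => a.eval pb s j / b.eval pb s j
  | _, .le a b => fun j =>
      haveI := Classical.propDecidable (a.eval pb s j ≤ b.eval pb s j)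
      if a.eval pb s j ≤ b.eval pb s j then 1 else 0
  | _, .exp a => fun j => Real.exp (a.eval pb s j)
  | _, .log a => fun j => Real.log (a.eval pb s j)
  | _, .bcast _ a => fun _ => a.eval pb s (0 : Fin 1)
  | _, .sum a => fun _ => ∑ j, a.eval pb s j
  | _, .loss k a => fun j => iteratedDeriv k pb.f (a.eval pb s j)
  | _, .mulP a => pb.P *ᵥ (show Fin n → ℝ from a.eval pb s)
  | _, .mulPT a => pb.Pᵀ *ᵥ (show Fin m → ℝ from a.eval pb s)

/-- The value of a scalar expression. -/
noncomputable def Expr.val (pb : Problem d n m) (s : Store n m) (a : Expr .scal) : ℝ :=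
  a.eval pb s (0 : Fin 1)

inductive Prog
  /-- register `i` of kind `κ` := value of the expression -/
  | assign (κ : Kind) (i : ℕ) (a : Expr κ)
  /-- register `i` of kind `prim` := `Δ`-part of the solution of
  `Pᵀ diag(r) P Δ + Aᵀ μ = c`, `A Δ = 0` -/
  | solve (i : ℕ) (r : Expr .rows) (c : Expr .prim)
  | seq (p q : Prog)
  /-- if `a ≤ b` then `p` else `q` -/
  | branch (a b : Expr .scal) (p q : Prog)
  /-- while `a ≤ b` do `p` -/
  | loop (a b : Expr .scal) (p : Prog)

/-- `Exec pb S p s s' k l`: with the solver `S`, the program `p`, started in the store `s`, halts in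
the store `s'` after `k` calls to the solver and `l` other steps (assignments and tests). -/
inductive Exec (pb : Problem d n m) (S : SolverMap d n) :
    Prog → Store n m → Store n m → ℕ → ℕ → Prop
  | assign (κ : Kind) (i : ℕ) (a : Expr κ) (s : Store n m) :
      Exec pb S (.assign κ i a) s (s.set κ i (a.eval pb s)) 0 1
  | solve (i : ℕ) (r : Expr .rows) (c : Expr .prim) (s : Store n m) :
      Exec pb S (.solve i r c) s
        (s.set .prim i (pb.solve S (r.eval pb s) (c.eval pb s))) 1 0
  | seq {p q : Prog} {s₁ s₂ s₃ : Store n m} {k₁ l₁ k₂ l₂ : ℕ}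
      (h₁ : Exec pb S p s₁ s₂ k₁ l₁) (h₂ : Exec pb S q s₂ s₃ k₂ l₂) :
      Exec pb S (.seq p q) s₁ s₃ (k₁ + k₂) (l₁ + l₂)
  | branch_true {a b : Expr .scal} {p q : Prog} {s s' : Store n m} {k l : ℕ}
      (h : a.val pb s ≤ b.val pb s) (h₁ : Exec pb S p s s' k l) :
      Exec pb S (.branch a b p q) s s' k (l + 1)
  | branch_false {a b : Expr .scal} {p q : Prog} {s s' : Store n m} {k l : ℕ}
      (h : ¬ a.val pb s ≤ b.val pb s) (h₁ : Exec pb S q s s' k l) :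
      Exec pb S (.branch a b p q) s s' k (l + 1)
  | loop_done {a b : Expr .scal} {p : Prog} {s : Store n m}
      (h : ¬ a.val pb s ≤ b.val pb s) :
      Exec pb S (.loop a b p) s s 0 1
  | loop_step {a b : Expr .scal} {p : Prog} {s₁ s₂ s₃ : Store n m} {k₁ l₁ k₂ l₂ : ℕ}
      (h : a.val pb s₁ ≤ b.val pb s₁) (h₁ : Exec pb S p s₁ s₂ k₁ l₁)
      (h₂ : Exec pb S (.loop a b p) s₂ s₃ k₂ l₂) :
      Exec pb S (.loop a b p) s₁ s₃ (k₁ + k₂) (l₁ + l₂ + 1)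

/-- The input: `M`, `R`, `ε` in the first three scalar registers, the starting point in the first
register for vectors of `ℝⁿ`, and zeros elsewhere. -/
def Store.input (m : ℕ) (M R ε : ℝ) (x₀ : Fin n → ℝ) : Store n m
  | .scal, 0 => fun _ => M
  | .scal, 1 => fun _ => R
  | .scal, 2 => fun _ => ε
  | .prim, 0 => x₀
  | _, _ => fun _ => 0

/-- The output: the first register for vectors of `ℝⁿ`. -/
def Store.output (s : Store n m) : Fin n → ℝ := s .prim 0

end QSC

namespace QSC

variable {d n m : ℕ}

/-! ### Reading and writing registers -/

/-- The `i`-th scalar register. -/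
def Store.sc (s : Store n m) (i : ℕ) : ℝ := s .scal i (0 : Fin 1)

/-- The `i`-th register for vectors of `ℝⁿ`. -/
def Store.pr (s : Store n m) (i : ℕ) : Fin n → ℝ := s .prim i

/-- The `i`-th register for vectors of `ℝᵐ`. -/
def Store.ro (s : Store n m) (i : ℕ) : Fin m → ℝ := s .rows i

def Store.setS (s : Store n m) (i : ℕ) (c : ℝ) : Store n m := s.set .scal i (fun _ => c)
def Store.setP (s : Store n m) (i : ℕ) (v : Fin n → ℝ) : Store n m := s.set .prim i v
def Store.setR (s : Store n m) (i : ℕ) (v : Fin m → ℝ) : Store n m := s.set .rows i v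

theorem Store.set_self (s : Store n m) (κ : Kind) (i : ℕ) (v) (j : ℕ) :
    (s.set κ i v) κ j = if j = i then v else s κ j := by
  simp [Store.set, Function.update_apply]

theorem Store.set_ne (s : Store n m) {κ κ' : Kind} (h : κ' ≠ κ) (i : ℕ) (v) :
    (s.set κ i v) κ' = s κ' := by
  simp [Store.set, Function.update_of_ne h]

variable (s : Store n m) (i j : ℕ)

@[simp] theorem Store.sc_setS (c : ℝ) :
    (s.setS i c).sc j = if j = i then c else s.sc j := by
  rw [Store.sc, Store.setS, Store.set_self]; split_ifs <;> rfl
@[simp] theorem Store.sc_setP (v : Fin n → ℝ) : (s.setP i v).sc j = s.sc j :=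
  congrFun (congrFun (Store.set_ne s (by decide : Kind.scal ≠ Kind.prim) i (v)) j) (0 : Fin 1)
@[simp] theorem Store.sc_setR (v : Fin m → ℝ) : (s.setR i v).sc j = s.sc j :=
  congrFun (congrFun (Store.set_ne s (by decide : Kind.scal ≠ Kind.rows) i (v)) j) (0 : Fin 1)
@[simp] theorem Store.pr_setP (v : Fin n → ℝ) :
    (s.setP i v).pr j = if j = i then v else s.pr j :=
  Store.set_self s .prim i v j
@[simp] theorem Store.pr_setS (c : ℝ) : (s.setS i c).pr j = s.pr j :=
  congrFun (Store.set_ne s (by decide : Kind.prim ≠ Kind.scal) i (fun _ => c)) j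
@[simp] theorem Store.pr_setR (v : Fin m → ℝ) : (s.setR i v).pr j = s.pr j :=
  congrFun (Store.set_ne s (by decide : Kind.prim ≠ Kind.rows) i (v)) j
@[simp] theorem Store.ro_setR (v : Fin m → ℝ) :
    (s.setR i v).ro j = if j = i then v else s.ro j :=
  Store.set_self s .rows i v j
@[simp] theorem Store.ro_setS (c : ℝ) : (s.setS i c).ro j = s.ro j :=
  congrFun (Store.set_ne s (by decide : Kind.rows ≠ Kind.scal) i (fun _ => c)) j
@[simp] theorem Store.ro_setP (v : Fin n → ℝ) : (s.setP i v).ro j = s.ro j :=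
  congrFun (Store.set_ne s (by decide : Kind.rows ≠ Kind.prim) i (v)) j

/-! ### Values of expressions -/

instance (κ : Kind) : Add (Expr κ) := ⟨Expr.add⟩
instance (κ : Kind) : Sub (Expr κ) := ⟨Expr.sub⟩
instance (κ : Kind) : Mul (Expr κ) := ⟨Expr.mul⟩
instance (κ : Kind) : Div (Expr κ) := ⟨Expr.div⟩

variable (pb : Problem d n m)

noncomputable def Expr.vecP (a : Expr .prim) : Fin n → ℝ := a.eval pb s
noncomputable def Expr.vecR (a : Expr .rows) : Fin m → ℝ := a.eval pb s

section scal
variable (a b : Expr .scal) (q : ℚ)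
@[simp] theorem val_var : (Expr.var .scal i).val pb s = s.sc i := rfl
@[simp] theorem val_const : (Expr.const q).val pb s = q := rfl
@[simp] theorem val_add : (a + b).val pb s = a.val pb s + b.val pb s := rfl
@[simp] theorem val_sub : (a - b).val pb s = a.val pb s - b.val pb s := rfl
@[simp] theorem val_mul : (a * b).val pb s = a.val pb s * b.val pb s := rfl
@[simp] theorem val_div : (a / b).val pb s = a.val pb s / b.val pb s := rfl
@[simp] theorem val_exp : (Expr.exp a).val pb s = Real.exp (a.val pb s) := rfl
@[simp] theorem val_log : (Expr.log a).val pb s = Real.log (a.val pb s) := rfl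
@[simp] theorem val_le :
    (Expr.le a b).val pb s = if a.val pb s ≤ b.val pb s then 1 else 0 := by
  by_cases h : a.val pb s ≤ b.val pb s
  · rw [if_pos h]; exact if_pos h
  · rw [if_neg h]; exact if_neg h
@[simp] theorem val_sumP (a : Expr .prim) : (Expr.sum a).val pb s = ∑ j, a.vecP s pb j := rfl
@[simp] theorem val_sumR (a : Expr .rows) : (Expr.sum a).val pb s = ∑ j, a.vecR s pb j := rfl
end scal

section prim
variable (a b : Expr .prim)
@[simp] theorem vecP_var : (Expr.var .prim i).vecP s pb = s.pr i := rfl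
@[simp] theorem vecP_add : (a + b).vecP s pb = a.vecP s pb + b.vecP s pb := rfl
@[simp] theorem vecP_mul : (a * b).vecP s pb = a.vecP s pb * b.vecP s pb := rfl
@[simp] theorem vecP_bcast (c : Expr .scal) :
    (Expr.bcast .prim c).vecP s pb = fun _ => c.val pb s := rfl
@[simp] theorem vecP_mulPT (c : Expr .rows) :
    (Expr.mulPT c).vecP s pb = pb.Pᵀ *ᵥ c.vecR s pb := rfl
end prim

section rows
variable (a b : Expr .rows)
@[simp] theorem vecR_var : (Expr.var .rows i).vecR s pb = s.ro i := rfl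
@[simp] theorem vecR_add : (a + b).vecR s pb = a.vecR s pb + b.vecR s pb := rfl
@[simp] theorem vecR_sub : (a - b).vecR s pb = a.vecR s pb - b.vecR s pb := rfl
@[simp] theorem vecR_mul : (a * b).vecR s pb = a.vecR s pb * b.vecR s pb := rfl
@[simp] theorem vecR_div : (a / b).vecR s pb = a.vecR s pb / b.vecR s pb := rfl
@[simp] theorem vecR_exp : (Expr.exp a).vecR s pb = fun j => Real.exp (a.vecR s pb j) := rfl
@[simp] theorem vecR_loss (k : Fin 3) :
    (Expr.loss k a).vecR s pb = fun j => iteratedDeriv k pb.f (a.vecR s pb j) := rfl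
@[simp] theorem vecR_bcast (c : Expr .scal) :
    (Expr.bcast .rows c).vecR s pb = fun _ => c.val pb s := rfl
@[simp] theorem vecR_mulP (c : Expr .prim) :
    (Expr.mulP c).vecR s pb = pb.P *ᵥ c.vecP s pb := rfl
@[simp] theorem vecR_le :
    (Expr.le a b).vecR s pb = fun j => if a.vecR s pb j ≤ b.vecR s pb j then 1 else 0 := by
  funext j
  by_cases h : a.vecR s pb j ≤ b.vecR s pb j
  · rw [if_pos h]; exact if_pos h
  · rw [if_neg h]; exact if_neg h
end rows

/-! ### Runs with a cost bound -/

variable {pb s} {S : SolverMap d n}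

/-- Started in `s`, the program `p` halts in a store that satisfies `Q`, after at most `c` solver
calls and at most `c` other steps. -/
def Run (pb : Problem d n m) (S : SolverMap d n) (p : Prog) (s : Store n m)
    (Q : Store n m → Prop) (c : ℝ) : Prop :=
  ∃ s' k l, Exec pb S p s s' k l ∧ Q s' ∧ (k : ℝ) ≤ c ∧ (l : ℝ) ≤ c

theorem Run.mono {p : Prog} {Q Q' : Store n m → Prop} {c c' : ℝ} (h : Run pb S p s Q c)
    (hQ : ∀ s, Q s → Q' s) (hc : c ≤ c') : Run pb S p s Q' c' := by
  obtain ⟨s', k, l, he, hq, hk, hl⟩ := h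
  exact ⟨s', k, l, he, hQ _ hq, hk.trans hc, hl.trans hc⟩

theorem Run.assignS {i : ℕ} {a : Expr .scal} {Q : Store n m → Prop} {c : ℝ}
    (h : Q (s.setS i (a.val pb s))) (hc : 1 ≤ c) : Run pb S (.assign .scal i a) s Q c := by
  refine ⟨_, 0, 1, Exec.assign .scal i a s, ?_, by push_cast; linarith, by simpa⟩
  convert h using 1
  rw [Store.setS]
  congr 1
  funext j
  exact congrArg (a.eval pb s) (Subsingleton.elim (α := Fin 1) _ _)

theorem Run.assignP {i : ℕ} {a : Expr .prim} {Q : Store n m → Prop} {c : ℝ}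
    (h : Q (s.setP i (a.vecP s pb))) (hc : 1 ≤ c) : Run pb S (.assign .prim i a) s Q c :=
  ⟨_, 0, 1, Exec.assign .prim i a s, h, by push_cast; linarith, by simpa⟩

theorem Run.assignR {i : ℕ} {a : Expr .rows} {Q : Store n m → Prop} {c : ℝ}
    (h : Q (s.setR i (a.vecR s pb))) (hc : 1 ≤ c) : Run pb S (.assign .rows i a) s Q c :=
  ⟨_, 0, 1, Exec.assign .rows i a s, h, by push_cast; linarith, by simpa⟩

theorem Run.solve {i : ℕ} {r : Expr .rows} {a : Expr .prim} {Q : Store n m → Prop} {c : ℝ}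
    (h : Q (s.setP i (pb.solve S (r.vecR s pb) (a.vecP s pb)))) (hc : 1 ≤ c) :
    Run pb S (.solve i r a) s Q c :=
  ⟨_, 1, 0, Exec.solve i r a s, h, by simpa, by push_cast; linarith⟩

theorem Run.seq {p q : Prog} {Q₁ Q : Store n m → Prop} {c₁ c : ℝ} (h₁ : Run pb S p s Q₁ c₁)
    (h₂ : ∀ s', Q₁ s' → Run pb S q s' Q (c - c₁)) : Run pb S (.seq p q) s Q c := by
  obtain ⟨s', k, l, he, hq, hk, hl⟩ := h₁
  obtain ⟨s'', k', l', he', hq', hk', hl'⟩ := h₂ s' hq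
  exact ⟨s'', k + k', l + l', he.seq he', hq', by push_cast; linarith, by push_cast; linarith⟩

theorem Run.seqS {i : ℕ} {a : Expr .scal} {q : Prog} {Q : Store n m → Prop} {c : ℝ}
    (h : Run pb S q (s.setS i (a.val pb s)) Q (c - 1)) :
    Run pb S (.seq (.assign .scal i a) q) s Q c :=
  Run.seq (Q₁ := fun s' => s' = s.setS i (a.val pb s)) (Run.assignS rfl le_rfl)
    (by rintro _ rfl; exact h)

theorem Run.seqP {i : ℕ} {a : Expr .prim} {q : Prog} {Q : Store n m → Prop} {c : ℝ}
    (h : Run pb S q (s.setP i (a.vecP s pb)) Q (c - 1)) :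
    Run pb S (.seq (.assign .prim i a) q) s Q c :=
  Run.seq (Q₁ := fun s' => s' = s.setP i (a.vecP s pb)) (Run.assignP rfl le_rfl)
    (by rintro _ rfl; exact h)

theorem Run.seqR {i : ℕ} {a : Expr .rows} {q : Prog} {Q : Store n m → Prop} {c : ℝ}
    (h : Run pb S q (s.setR i (a.vecR s pb)) Q (c - 1)) :
    Run pb S (.seq (.assign .rows i a) q) s Q c :=
  Run.seq (Q₁ := fun s' => s' = s.setR i (a.vecR s pb)) (Run.assignR rfl le_rfl)
    (by rintro _ rfl; exact h)

theorem Run.seqSolve {i : ℕ} {r : Expr .rows} {a : Expr .prim} {q : Prog}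
    {Q : Store n m → Prop} {c : ℝ}
    (h : Run pb S q (s.setP i (pb.solve S (r.vecR s pb) (a.vecP s pb))) Q (c - 1)) :
    Run pb S (.seq (.solve i r a) q) s Q c :=
  Run.seq (Q₁ := fun s' => s' = s.setP i (pb.solve S (r.vecR s pb) (a.vecP s pb)))
    (Run.solve rfl le_rfl) (by rintro _ rfl; exact h)

theorem Run.branch {a b : Expr .scal} {p q : Prog} {Q : Store n m → Prop} {c : ℝ}
    (h₁ : a.val pb s ≤ b.val pb s → Run pb S p s Q (c - 1))
    (h₂ : ¬ a.val pb s ≤ b.val pb s → Run pb S q s Q (c - 1)) :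
    Run pb S (.branch a b p q) s Q c := by
  by_cases h : a.val pb s ≤ b.val pb s
  · obtain ⟨s', k, l, he, hq, hk, hl⟩ := h₁ h
    exact ⟨s', k, l + 1, he.branch_true h, hq, by linarith, by push_cast; linarith⟩
  · obtain ⟨s', k, l, he, hq, hk, hl⟩ := h₂ h
    exact ⟨s', k, l + 1, he.branch_false h, hq, by linarith, by push_cast; linarith⟩

theorem Run.loop_aux {a b : Expr .scal} {p : Prog} {I : ℕ → Store n m → Prop} {B c : ℝ}
    (hc : 0 ≤ c)
    (hstep : ∀ j s, I j s → a.val pb s ≤ b.val pb s → (j : ℝ) ≤ B ∧ Run pb S p s (I (j + 1)) c)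
    (r : ℕ) : ∀ j s, I j s → B < (j + r : ℝ) →
      Run pb S (.loop a b p) s (fun s' => (∃ j, I j s') ∧ ¬ a.val pb s' ≤ b.val pb s')
        (r * (c + 1) + 1) := by
  induction r with
  | zero =>
    intro j s hI hB
    have hn : ¬ a.val pb s ≤ b.val pb s := fun h => by
      have := (hstep j s hI h).1
      push_cast at hB; linarith
    exact ⟨s, 0, 1, Exec.loop_done hn, ⟨⟨j, hI⟩, hn⟩, by norm_num, by norm_num⟩
  | succ r ih =>
    intro j s hI hB
    by_cases h : a.val pb s ≤ b.val pb s
    · obtain ⟨s', k, l, he, hq, hk, hl⟩ := (hstep j s hI h).2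
      obtain ⟨s'', k', l', he', hq', hk', hl'⟩ := ih (j + 1) s' hq (by push_cast at hB ⊢; linarith)
      exact ⟨s'', _, _, Exec.loop_step h he he', hq', by push_cast; linarith,
        by push_cast; linarith⟩
    · refine ⟨s, 0, 1, Exec.loop_done h, ⟨⟨j, hI⟩, h⟩, ?_, ?_⟩ <;> push_cast <;>
        nlinarith [mul_nonneg (Nat.cast_nonneg (α := ℝ) r) hc, Nat.cast_nonneg (α := ℝ) r]

/-- A loop whose body costs at most `c`, with an invariant `I j` after `j` rounds that allows a
further round only if `j ≤ B`. -/
theorem Run.loop {a b : Expr .scal} {p : Prog} {I : ℕ → Store n m → Prop} {B c : ℝ}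
    (hc : 0 ≤ c) (hB : 0 ≤ B)
    (hstep : ∀ j s, I j s → a.val pb s ≤ b.val pb s → (j : ℝ) ≤ B ∧ Run pb S p s (I (j + 1)) c)
    (h0 : I 0 s) :
    Run pb S (.loop a b p) s (fun s' => (∃ j, I j s') ∧ ¬ a.val pb s' ≤ b.val pb s')
      ((B + 1) * (c + 1) + 1) := by
  refine (Run.loop_aux hc hstep (⌊B⌋₊ + 1) 0 s h0 ?_).mono (fun _ h => h) ?_
  · push_cast; rw [zero_add]; exact Nat.lt_floor_add_one B
  · push_cast
    have := Nat.floor_le hB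
    have : (⌊B⌋₊ + 1 : ℝ) * (c + 1) ≤ (B + 1) * (c + 1) := by gcongr
    linarith

end QSC

namespace QSC

/-! ### Quasi-self-concordant functions -/

/-- `φ` is `M`-quasi-self-concordant with derivatives `φ₁`, `φ₂`, `φ₃`. -/
structure QSCDeriv (φ φ₁ φ₂ φ₃ : ℝ → ℝ) (M : ℝ) : Prop where
  h0 : ∀ t, HasDerivAt φ (φ₁ t) t
  h1 : ∀ t, HasDerivAt φ₁ (φ₂ t) t
  h2 : ∀ t, HasDerivAt φ₂ (φ₃ t) t
  bd : ∀ t, |φ₃ t| ≤ M * φ₂ t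
  pos : 0 < M

theorem IsQuasiSelfConcordant.qscDeriv {f : ℝ → ℝ} {M : ℝ} (h : IsQuasiSelfConcordant f M) :
    QSCDeriv f (iteratedDeriv 1 f) (iteratedDeriv 2 f) (iteratedDeriv 3 f) M := by
  obtain ⟨hM, hf, hb⟩ := h
  have key : ∀ k : ℕ, k < 3 → ∀ t,
      HasDerivAt (iteratedDeriv k f) (iteratedDeriv (k + 1) f t) t := by
    intro k hk t
    rw [iteratedDeriv_succ]
    refine DifferentiableAt.hasDerivAt ?_
    exact (hf.differentiable_iteratedDeriv k (by exact_mod_cast hk)) t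
  refine ⟨fun t => ?_, key 1 (by norm_num), key 2 (by norm_num), hb, hM⟩
  simpa using key 0 (by norm_num) t

/-- A function with nonnegative second derivative lies above its tangent. -/
theorem tangent_le {H H₁ H₂ : ℝ → ℝ} (h0 : ∀ s, HasDerivAt H (H₁ s) s)
    (h1 : ∀ s, HasDerivAt H₁ (H₂ s) s) (hn : ∀ s ∈ Set.Icc (0 : ℝ) 1, 0 ≤ H₂ s) :
    H 0 + H₁ 0 ≤ H 1 := by
  have m1 : MonotoneOn H₁ (Set.Icc 0 1) := by
    refine monotoneOn_of_deriv_nonneg (convex_Icc 0 1)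
      (fun s _ => (h1 s).continuousAt.continuousWithinAt)
      (fun s _ => (h1 s).differentiableAt.differentiableWithinAt) fun s hs => ?_
    rw [(h1 s).deriv]
    exact hn s (interior_subset hs)
  have hd : ∀ s, HasDerivAt (fun s => H s - H₁ 0 * s) (H₁ s - H₁ 0) s := fun s =>
    ((h0 s).sub ((hasDerivAt_id s).const_mul (H₁ 0))).congr_deriv (by ring)
  have m2 : MonotoneOn (fun s => H s - H₁ 0 * s) (Set.Icc 0 1) := by
    refine monotoneOn_of_deriv_nonneg (convex_Icc 0 1)
      (fun s _ => (hd s).continuousAt.continuousWithinAt)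
      (fun s _ => (hd s).differentiableAt.differentiableWithinAt) fun s hs => ?_
    rw [(hd s).deriv]
    have hs' := interior_subset hs
    linarith [m1 (Set.left_mem_Icc.2 zero_le_one) hs' hs'.1]
  have := m2 (Set.left_mem_Icc.2 zero_le_one) (Set.right_mem_Icc.2 zero_le_one) zero_le_one
  simp only at this
  linarith

namespace QSCDeriv
variable {φ φ₁ φ₂ φ₃ : ℝ → ℝ} {M : ℝ}

theorem nonneg (h : QSCDeriv φ φ₁ φ₂ φ₃ M) (t : ℝ) : 0 ≤ φ₂ t :=
  nonneg_of_mul_nonneg_right ((abs_nonneg _).trans (h.bd t)) h.pos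

theorem growth (h : QSCDeriv φ φ₁ φ₂ φ₃ M) (t u : ℝ) :
    φ₂ (t + u) ≤ Real.exp (M * |u|) * φ₂ t := by
  have hd : ∀ c s, HasDerivAt (fun s => Real.exp (c * s) * φ₂ s)
      (Real.exp (c * s) * (c * φ₂ s + φ₃ s)) s := fun c s => by
    have h1 : HasDerivAt (fun s => Real.exp (c * s)) (Real.exp (c * s) * c) s := by
      simpa using ((hasDerivAt_id s).const_mul c).exp
    exact (h1.mul (h.h2 s)).congr_deriv (by ring)
  rcases le_total 0 u with hu | hu
  · have ha : Antitone fun s => Real.exp (-M * s) * φ₂ s := by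
      refine antitone_of_deriv_nonpos (fun s => (hd _ s).differentiableAt) fun s => ?_
      rw [(hd _ s).deriv]
      refine mul_nonpos_of_nonneg_of_nonpos (Real.exp_nonneg _) ?_
      linarith [le_abs_self (φ₃ s), h.bd s]
    have := ha (show t ≤ t + u by linarith)
    simp only at this
    rw [abs_of_nonneg hu]
    have e : Real.exp (M * u) = Real.exp (M * (t + u)) * Real.exp (-M * t) := by
      rw [← Real.exp_add]; ring_nf
    have e2 : Real.exp (M * (t + u)) * Real.exp (-M * (t + u)) = 1 := by
      rw [← Real.exp_add]; ring_nf; exact Real.exp_zero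
    calc φ₂ (t + u) = Real.exp (M * (t + u)) * (Real.exp (-M * (t + u)) * φ₂ (t + u)) := by
          rw [← mul_assoc, e2, one_mul]
      _ ≤ Real.exp (M * (t + u)) * (Real.exp (-M * t) * φ₂ t) := by gcongr
      _ = _ := by rw [e, mul_assoc]
  · have ha : Monotone fun s => Real.exp (M * s) * φ₂ s := by
      refine monotone_of_deriv_nonneg (fun s => (hd _ s).differentiableAt) fun s => ?_
      rw [(hd _ s).deriv]
      refine mul_nonneg (Real.exp_nonneg _) ?_
      linarith [neg_abs_le (φ₃ s), h.bd s]
    have := ha (show t + u ≤ t by linarith)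
    simp only at this
    rw [abs_of_nonpos hu]
    have e : Real.exp (M * -u) = Real.exp (-M * (t + u)) * Real.exp (M * t) := by
      rw [← Real.exp_add]; ring_nf
    have e2 : Real.exp (-M * (t + u)) * Real.exp (M * (t + u)) = 1 := by
      rw [← Real.exp_add]; ring_nf; exact Real.exp_zero
    calc φ₂ (t + u) = Real.exp (-M * (t + u)) * (Real.exp (M * (t + u)) * φ₂ (t + u)) := by
          rw [← mul_assoc, e2, one_mul]
      _ ≤ Real.exp (-M * (t + u)) * (Real.exp (M * t) * φ₂ t) := by gcongr
      _ = _ := by rw [e, mul_assoc]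

theorem growth_three (h : QSCDeriv φ φ₁ φ₂ φ₃ M) {t u : ℝ} (hu : M * |u| ≤ 1) :
    φ₂ (t + u) ≤ 3 * φ₂ t := by
  refine (h.growth t u).trans (mul_le_mul_of_nonneg_right ?_ (h.nonneg t))
  exact (Real.exp_le_exp.2 hu).trans (by linarith [Real.exp_one_lt_d9])

theorem mul_abs_le (hM : 0 < M) {u s : ℝ} (hu : M * |u| ≤ 1) (hs : s ∈ Set.Icc (0 : ℝ) 1) :
    M * |s * u| ≤ 1 := by
  rw [abs_mul, abs_of_nonneg hs.1]
  have : s * |u| ≤ 1 * |u| := mul_le_mul_of_nonneg_right hs.2 (abs_nonneg _)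
  have := mul_le_mul_of_nonneg_left this hM.le
  linarith

theorem hasDerivAt_line {g g' : ℝ → ℝ} (hg : ∀ t, HasDerivAt g (g' t) t) (t u s : ℝ) :
    HasDerivAt (fun s => g (t + s * u)) (g' (t + s * u) * u) s := by
  have : HasDerivAt (fun s : ℝ => t + s * u) u s := by
    simpa using ((hasDerivAt_id s).mul_const u).const_add t
  exact (hg _).comp s this

theorem le_quadratic (h : QSCDeriv φ φ₁ φ₂ φ₃ M) {t u : ℝ} (hu : M * |u| ≤ 1) :
    φ (t + u) ≤ φ t + φ₁ t * u + 3 / 2 * (φ₂ t * u ^ 2) := by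
  have := tangent_le (H := fun s => 3 / 2 * (φ₂ t * u ^ 2) * s ^ 2 - φ (t + s * u))
    (H₁ := fun s => 3 * (φ₂ t * u ^ 2) * s - φ₁ (t + s * u) * u)
    (H₂ := fun s => 3 * (φ₂ t * u ^ 2) - φ₂ (t + s * u) * u * u)
    (fun s => (((hasDerivAt_pow 2 s).const_mul (3 / 2 * (φ₂ t * u ^ 2))).sub
        (hasDerivAt_line h.h0 t u s)).congr_deriv (by push_cast; ring))
    (fun s => (((hasDerivAt_id s).const_mul (3 * (φ₂ t * u ^ 2))).sub
        ((hasDerivAt_line h.h1 t u s).mul_const u)).congr_deriv (by ring))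
    (fun s hs => by
      have := h.growth_three (t := t) (mul_abs_le h.pos hu hs)
      nlinarith [mul_le_mul_of_nonneg_right this (sq_nonneg u)])
  simp only [zero_mul, mul_zero, add_zero, one_mul, one_pow] at this
  norm_num at this
  linarith

theorem quadratic_le (h : QSCDeriv φ φ₁ φ₂ φ₃ M) {t u : ℝ} (hu : M * |u| ≤ 1) :
    φ t + φ₁ t * u + 1 / 6 * (φ₂ t * u ^ 2) ≤ φ (t + u) := by
  have := tangent_le (H := fun s => φ (t + s * u) - 1 / 6 * (φ₂ t * u ^ 2) * s ^ 2)
    (H₁ := fun s => φ₁ (t + s * u) * u - 1 / 3 * (φ₂ t * u ^ 2) * s)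
    (H₂ := fun s => φ₂ (t + s * u) * u * u - 1 / 3 * (φ₂ t * u ^ 2))
    (fun s => ((hasDerivAt_line h.h0 t u s).sub
        ((hasDerivAt_pow 2 s).const_mul (1 / 6 * (φ₂ t * u ^ 2)))).congr_deriv
        (by push_cast; ring))
    (fun s => (((hasDerivAt_line h.h1 t u s).mul_const u).sub
        ((hasDerivAt_id s).const_mul (1 / 3 * (φ₂ t * u ^ 2)))).congr_deriv (by ring))
    (fun s hs => by
      have := h.growth_three (t := t + s * u) (u := -(s * u))
        (by rw [abs_neg]; exact mul_abs_le h.pos hu hs)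
      rw [add_neg_cancel_right] at this
      nlinarith [mul_le_mul_of_nonneg_right this (sq_nonneg u)])
  simp only [zero_mul, mul_zero, add_zero, one_mul, one_pow] at this
  norm_num at this
  linarith

theorem convex (h : QSCDeriv φ φ₁ φ₂ φ₃ M) {θ : ℝ} (h0 : 0 ≤ θ) (h1 : θ ≤ 1) (t u : ℝ) :
    φ (t + θ * u) ≤ (1 - θ) * φ t + θ * φ (t + u) := by
  have d1 : deriv φ = φ₁ := funext fun t => (h.h0 t).deriv
  have d2 : deriv φ₁ = φ₂ := funext fun t => (h.h1 t).deriv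
  have hc : ConvexOn ℝ Set.univ φ := by
    refine convexOn_univ_of_deriv2_nonneg (fun t => (h.h0 t).differentiableAt) ?_ ?_
    · rw [d1]; exact fun t => (h.h1 t).differentiableAt
    · intro t
      simp only [Function.iterate_succ, Function.iterate_zero, Function.comp, id, d1, d2]
      exact h.nonneg t
  have := hc.2 (Set.mem_univ t) (Set.mem_univ (t + u)) (sub_nonneg.2 h1) h0 (by ring)
  simp only [smul_eq_mul] at this
  have e : (1 - θ) * t + θ * (t + u) = t + θ * u := by ring
  rwa [e] at this

end QSCDeriv

/-! ### The regularizer -/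

/-- The regularizer, at most `2` on `[-R, R]` and exponentially large far outside, and its first
two derivatives. -/
noncomputable def barrier (L R t : ℝ) : ℝ :=
  Real.exp (L * (t / R - 1)) + Real.exp (L * (-t / R - 1))
noncomputable def barrier₁ (L R t : ℝ) : ℝ :=
  (L / R) * (Real.exp (L * (t / R - 1)) - Real.exp (L * (-t / R - 1)))
noncomputable def barrier₂ (L R t : ℝ) : ℝ := (L / R) ^ 2 * barrier L R t

theorem barrier_pos (L R t : ℝ) : 0 < barrier L R t := by unfold barrier; positivity

theorem barrier_le_two {L R t : ℝ} (hL : 0 ≤ L) (hR : 0 < R) (ht : |t| ≤ R) :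
    barrier L R t ≤ 2 := by
  have h := abs_le.1 ht
  have h1 : Real.exp (L * (t / R - 1)) ≤ 1 := Real.exp_le_one_iff.2 <|
    mul_nonpos_of_nonneg_of_nonpos hL (by rw [sub_nonpos, div_le_one hR]; exact h.2)
  have h2 : Real.exp (L * (-t / R - 1)) ≤ 1 := Real.exp_le_one_iff.2 <|
    mul_nonpos_of_nonneg_of_nonpos hL (by rw [sub_nonpos, div_le_one hR]; linarith [h.1])
  unfold barrier; linarith

theorem exp_le_barrier (L R t : ℝ) : Real.exp (L * (|t| / R - 1)) ≤ barrier L R t := by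
  unfold barrier
  rcases abs_choice t with h | h <;> rw [h]
  · linarith [Real.exp_pos (L * (-t / R - 1))]
  · linarith [Real.exp_pos (L * (t / R - 1))]

theorem hasDerivAt_barrier_exp (L R c t : ℝ) :
    HasDerivAt (fun t => Real.exp (L * (c * t / R - 1)))
      (L / R * c * Real.exp (L * (c * t / R - 1))) t := by
  have : HasDerivAt (fun t : ℝ => L * (c * t / R - 1)) (L * (c / R)) t := by
    simpa using ((((hasDerivAt_id t).const_mul c).div_const R).sub_const 1).const_mul L
  exact this.exp.congr_deriv (by ring)

theorem QSCDeriv.add_barrier {φ φ₁ φ₂ φ₃ : ℝ → ℝ} {M L R c : ℝ} (h : QSCDeriv φ φ₁ φ₂ φ₃ M)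
    (hL : 0 < L) (hR : 0 < R) (hc : 0 ≤ c) :
    ∃ ψ₃, QSCDeriv (fun t => φ t + c * barrier L R t) (fun t => φ₁ t + c * barrier₁ L R t)
      (fun t => φ₂ t + c * barrier₂ L R t) ψ₃ (M + L / R) := by
  have e1 : ∀ t, HasDerivAt (fun t => Real.exp (L * (t / R - 1)))
      (L / R * Real.exp (L * (t / R - 1))) t := fun t => by
    simpa using hasDerivAt_barrier_exp L R 1 t
  have e2 : ∀ t, HasDerivAt (fun t => Real.exp (L * (-t / R - 1)))
      (-(L / R * Real.exp (L * (-t / R - 1)))) t := fun t => by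
    simpa using hasDerivAt_barrier_exp L R (-1) t
  have b0 : ∀ t, HasDerivAt (barrier L R) (barrier₁ L R t) t := fun t =>
    ((e1 t).add (e2 t)).congr_deriv (by unfold barrier₁; ring)
  have b1 : ∀ t, HasDerivAt (barrier₁ L R) (barrier₂ L R t) t := fun t =>
    (((e1 t).sub (e2 t)).const_mul (L / R)).congr_deriv (by unfold barrier₂ barrier; ring)
  have b2 : ∀ t, HasDerivAt (barrier₂ L R) ((L / R) ^ 2 * barrier₁ L R t) t := fun t =>
    (b0 t).const_mul _
  have hLR : 0 < L / R := div_pos hL hR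
  refine ⟨fun t => φ₃ t + c * ((L / R) ^ 2 * barrier₁ L R t),
    fun t => (h.h0 t).add ((b0 t).const_mul c), fun t => (h.h1 t).add ((b1 t).const_mul c),
    fun t => (h.h2 t).add ((b2 t).const_mul c), fun t => ?_, by linarith [h.pos]⟩
  have hb : |barrier₁ L R t| ≤ L / R * barrier L R t := by
    unfold barrier₁ barrier
    rw [abs_mul, abs_of_pos hLR]
    refine mul_le_mul_of_nonneg_left ?_ hLR.le
    rw [abs_le]
    constructor <;>
      linarith [Real.exp_pos (L * (t / R - 1)), Real.exp_pos (L * (-t / R - 1))]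
  have hp : 0 ≤ c * (L / R) ^ 2 := by positivity
  calc |φ₃ t + c * ((L / R) ^ 2 * barrier₁ L R t)|
      ≤ |φ₃ t| + |c * ((L / R) ^ 2 * barrier₁ L R t)| := abs_add_le _ _
    _ = |φ₃ t| + c * (L / R) ^ 2 * |barrier₁ L R t| := by
        rw [← mul_assoc, abs_mul, abs_of_nonneg hp]
    _ ≤ M * φ₂ t + c * (L / R) ^ 2 * (L / R * barrier L R t) := by
        gcongr; exact h.bd t
    _ ≤ (M + L / R) * (φ₂ t + c * barrier₂ L R t) := by
        have h1 : 0 ≤ L / R * φ₂ t := mul_nonneg hLR.le (h.nonneg t)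
        have h2 : 0 ≤ M * (c * barrier₂ L R t) := by
          have := h.pos; have := barrier_pos L R t
          unfold barrier₂; positivity
        have : (M + L / R) * (φ₂ t + c * barrier₂ L R t) = M * φ₂ t
          + c * (L / R) ^ 2 * (L / R * barrier L R t) + L / R * φ₂ t + M * (c * barrier₂ L R t) := by
          unfold barrier₂; ring
        linarith

end QSC

namespace QSC
variable {d n m : ℕ}

/-! ### Weighted least squares -/

theorem exists_mulVec_eq_of_isSymm {ι : Type*} [Fintype ι] [DecidableEq ι] {K : Matrix ι ι ℝ}
    (hK : K.IsSymm) {c : ι → ℝ} (h : ∀ z, K *ᵥ z = 0 → c ⬝ᵥ z = 0) : ∃ u, K *ᵥ u = c := by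
  have hT : (Matrix.toEuclideanLin K).IsSymmetric := by
    rw [Matrix.isSymmetric_toEuclideanLin_iff]
    rw [Matrix.IsHermitian, Matrix.conjTranspose_eq_transpose_of_trivial]
    exact hK
  have hc : WithLp.toLp 2 c ∈ (Matrix.toEuclideanLin K).range := by
    rw [← Submodule.orthogonal_orthogonal (Matrix.toEuclideanLin K).range, hT.orthogonal_range,
      Submodule.mem_orthogonal]
    intro z hz
    have hz' : K *ᵥ z.ofLp = 0 := by
      have := congrArg WithLp.ofLp (LinearMap.mem_ker.1 hz)
      simpa using this
    have := h _ hz'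
    rw [EuclideanSpace.inner_eq_star_dotProduct]
    simpa using this
  obtain ⟨u, hu⟩ := hc
  refine ⟨u.ofLp, ?_⟩
  have := congrArg WithLp.ofLp hu
  simpa using this

/-- `Δ` minimizes `∑ i, q i * ((P Δ) i)² / 2 - ∑ i, v i * (P Δ) i` subject to `A Δ = 0`. -/
structure Stationary (pb : Problem d n m) (q v : Fin m → ℝ) (Δ : Fin n → ℝ) : Prop where
  mem : pb.A *ᵥ Δ = 0
  eq : ∀ D, pb.A *ᵥ D = 0 →
    ∑ i, q i * (pb.P *ᵥ Δ) i * (pb.P *ᵥ D) i = ∑ i, v i * (pb.P *ᵥ D) i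

theorem kkt_mulVec (pb : Problem d n m) (q : Fin m → ℝ) (u : Fin n ⊕ Fin d → ℝ) :
    pb.kkt q *ᵥ u = Sum.elim
      (pb.Pᵀ *ᵥ (q * (pb.P *ᵥ (u ∘ Sum.inl))) + pb.Aᵀ *ᵥ (u ∘ Sum.inr))
      (pb.A *ᵥ (u ∘ Sum.inl)) := by
  rw [Problem.kkt, Matrix.fromBlocks_mulVec]
  congr 1
  · rw [← Matrix.mulVec_mulVec, ← Matrix.mulVec_mulVec]
    congr 2
    funext i
    rw [Matrix.mulVec_diagonal]; rfl
  · simp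

theorem mulVec_transpose_dotProduct {a b : ℕ} (B : Matrix (Fin a) (Fin b) ℝ) (x : Fin a → ℝ)
    (y : Fin b → ℝ) : (Bᵀ *ᵥ x) ⬝ᵥ y = x ⬝ᵥ (B *ᵥ y) := by
  rw [Matrix.mulVec_transpose, Matrix.dotProduct_mulVec]

theorem stationary_solve (pb : Problem d n m) {S : SolverMap d n} (hS : IsLinearSolver S)
    {q : Fin m → ℝ} (hq : ∀ i, 0 < q i) (v : Fin m → ℝ) :
    Stationary pb q v (pb.solve S q (pb.Pᵀ *ᵥ v)) := by
  have hsymm : (pb.kkt q).IsSymm := by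
    rw [Problem.kkt, Matrix.IsSymm, Matrix.fromBlocks_transpose]
    simp [Matrix.transpose_mul, Matrix.mul_assoc]
  have hex := exists_mulVec_eq_of_isSymm (K := pb.kkt q) hsymm
    (c := Sum.elim (pb.Pᵀ *ᵥ v) 0) ?_
  · have h := hS _ _ hex
    set u := S (pb.kkt q) (Sum.elim (pb.Pᵀ *ᵥ v) 0) with hu
    have hsol : pb.solve S q (pb.Pᵀ *ᵥ v) = u ∘ Sum.inl := rfl
    rw [hsol]
    rw [kkt_mulVec] at h
    have h1 := congrArg (fun g => g ∘ Sum.inl) h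
    have h2 := congrArg (fun g => g ∘ Sum.inr) h
    simp only [Sum.elim_comp_inl, Sum.elim_comp_inr] at h1 h2
    refine ⟨h2, fun D hD => ?_⟩
    have h3 := congrArg (fun g => g ⬝ᵥ D) h1
    simp only [add_dotProduct, mulVec_transpose_dotProduct, hD, dotProduct_zero, add_zero] at h3
    simpa [dotProduct] using h3
  · intro z hz
    rw [kkt_mulVec] at hz
    have h1 := congrArg (fun g => g ∘ Sum.inl) hz
    have h2 := congrArg (fun g => g ∘ Sum.inr) hz
    simp only [Sum.elim_comp_inl, Sum.elim_comp_inr] at h1 h2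
    have h2' : pb.A *ᵥ (z ∘ Sum.inl) = 0 := h2
    have h3 := congrArg (fun g => g ⬝ᵥ (z ∘ Sum.inl)) h1
    simp only [add_dotProduct, mulVec_transpose_dotProduct, h2', dotProduct_zero, add_zero] at h3
    have h4 : ∑ i, q i * (pb.P *ᵥ (z ∘ Sum.inl)) i ^ 2 = 0 := by
      have h3' : (q * pb.P *ᵥ (z ∘ Sum.inl)) ⬝ᵥ (pb.P *ᵥ (z ∘ Sum.inl)) = 0 := by
        rw [h3]; exact zero_dotProduct _
      rw [← h3']
      refine Finset.sum_congr rfl fun i _ => ?_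
      simp only [Pi.mul_apply]; ring
    have h5 : pb.P *ᵥ (z ∘ Sum.inl) = 0 := by
      funext i
      have := (Finset.sum_eq_zero_iff_of_nonneg
        (fun i _ => mul_nonneg (hq i).le (sq_nonneg _))).1 h4 i (Finset.mem_univ i)
      have := (mul_eq_zero.1 this).resolve_left (hq i).ne'
      simpa using this
    have e : Sum.elim (pb.Pᵀ *ᵥ v) 0 ⬝ᵥ z = (pb.Pᵀ *ᵥ v) ⬝ᵥ (z ∘ Sum.inl) := by
      simp [dotProduct, Fintype.sum_sum_type]
    rw [e, mulVec_transpose_dotProduct, h5, dotProduct_zero]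

/-- Increasing the weights increases the least energy. -/
theorem energy_increase {q q' y z : Fin m → ℝ} (hq : ∀ i, 0 < q i) (h1 : ∀ i, q i ≤ q' i)
    (h2 : ∀ i, q' i ≤ 2 * q i) (h : ∑ i, q i * y i * z i = ∑ i, q i * y i ^ 2) :
    ∑ i, q i * y i ^ 2 + 1 / 2 * ∑ i, (q' i - q i) * y i ^ 2 ≤ ∑ i, q' i * z i ^ 2 := by
  have key : ∀ i, 2 * (q i * y i * z i) - q i * y i ^ 2 + 1 / 2 * ((q' i - q i) * y i ^ 2)
      ≤ q' i * z i ^ 2 := fun i => by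
    have hq' : 0 < q' i := (hq i).trans_le (h1 i)
    have e : q' i * (q' i * z i ^ 2 - (2 * (q i * y i * z i) - q i * y i ^ 2
        + 1 / 2 * ((q' i - q i) * y i ^ 2)))
        = (q' i * z i - q i * y i) ^ 2
          + (q' i - q i) * (2 * q i - q' i) * y i ^ 2 / 2 := by ring
    have hn : 0 ≤ (q' i * z i - q i * y i) ^ 2
          + (q' i - q i) * (2 * q i - q' i) * y i ^ 2 / 2 := by
      have := mul_nonneg (sub_nonneg.2 (h1 i)) (sub_nonneg.2 (h2 i))
      positivity
    rw [← e] at hn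
    linarith [nonneg_of_mul_nonneg_right hn hq']
  have := Finset.sum_le_sum fun i (_ : i ∈ Finset.univ) => key i
  rw [Finset.sum_add_distrib, Finset.sum_sub_distrib, ← Finset.mul_sum, ← Finset.mul_sum, h] at this
  linarith

/-! ### Reweighting -/

/-- The weights of the least squares problem. -/
noncomputable def qw (μ G : ℝ) (w r : Fin m → ℝ) : Fin m → ℝ :=
  fun i => μ ^ 2 * r i + w i / (2 * G)

/-- The multiplicative update of the weights, with `u` the scaled coordinates and `ρ` the width. -/
noncomputable def reweight (ρ : ℝ) (u r : Fin m → ℝ) : Fin m → ℝ := fun i =>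
  r i * (1 + (if 3 ≤ |u i| then 1 else 0) * (if ρ ≤ |u i| then 1 else |u i| / ρ))

/-- `1` if all coordinates are smaller than `ρ`, and `0` otherwise. -/
noncomputable def narrow (ρ : ℝ) (u : Fin m → ℝ) : ℝ := by
  classical exact if ∀ i, |u i| < ρ then 1 else 0

theorem le_reweight {ρ : ℝ} (hρ : 0 < ρ) {u r : Fin m → ℝ} (hr : ∀ i, 0 < r i) (i : Fin m) :
    r i ≤ reweight ρ u r i := by
  unfold reweight
  have := hr i
  have : 0 ≤ r i * ((if 3 ≤ |u i| then (1 : ℝ) else 0) * (if ρ ≤ |u i| then 1 else |u i| / ρ)) := by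
    split_ifs <;> positivity
  linarith

theorem reweight_le {ρ : ℝ} (hρ : 0 < ρ) {u r : Fin m → ℝ} (hr : ∀ i, 0 < r i) (i : Fin m) :
    reweight ρ u r i ≤ 2 * r i := by
  unfold reweight
  have := hr i
  have : (if 3 ≤ |u i| then (1 : ℝ) else 0) * (if ρ ≤ |u i| then 1 else |u i| / ρ) ≤ 1 := by
    split_ifs with h1 h2 h2
    · norm_num
    · rw [one_mul, div_le_one hρ]; exact (not_le.1 h2).le
    · norm_num
    · norm_num
  nlinarith

theorem nine_mul_reweight_sub_le {ρ : ℝ} (hρ : 0 < ρ) {u r : Fin m → ℝ} (hr : ∀ i, 0 < r i)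
    (i : Fin m) : 9 * (reweight ρ u r i - r i) ≤ (reweight ρ u r i - r i) * u i ^ 2 := by
  by_cases h : 3 ≤ |u i|
  · have h1 := sub_nonneg.2 (le_reweight hρ hr (u := u) i)
    have h2 : 9 ≤ u i ^ 2 := by rw [← sq_abs]; nlinarith
    nlinarith
  · have : reweight ρ u r i = r i := by simp [reweight, h]
    simp [this]

theorem log_reweight {ρ : ℝ} (hρ : 0 < ρ) {u r : Fin m → ℝ} (hr : ∀ i, 0 < r i) {i : Fin m}
    (h : |u i| < ρ) {c : ℝ} (hc : 0 < c) :
    2 * ρ * Real.log (c * r i) + |u i| ≤ 3 + 2 * ρ * Real.log (c * reweight ρ u r i) := by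
  by_cases h3 : 3 ≤ |u i|
  · have e : reweight ρ u r i = r i * (1 + |u i| / ρ) := by
      simp [reweight, h3, not_le.2 h]
    have hx0 : 0 ≤ |u i| / ρ := by positivity
    have hx1 : |u i| / ρ ≤ 1 := by rw [div_le_one hρ]; exact h.le
    rw [e, ← mul_assoc, Real.log_mul (mul_pos hc (hr i)).ne' (by positivity)]
    have hlog : |u i| / ρ / 2 ≤ Real.log (1 + |u i| / ρ) := by
      have := Real.one_sub_inv_le_log_of_pos (show 0 < 1 + |u i| / ρ by positivity)
      refine le_trans ?_ this
      rw [show 1 - (1 + |u i| / ρ)⁻¹ = (|u i| / ρ) / (1 + |u i| / ρ) by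
        field_simp; ring]
      exact div_le_div_of_nonneg_left hx0 (by positivity) (by linarith)
    have : |u i| = 2 * ρ * (|u i| / ρ / 2) := by field_simp
    have := mul_le_mul_of_nonneg_left hlog (show 0 ≤ 2 * ρ by positivity)
    linarith
  · have e : reweight ρ u r i = r i := by simp [reweight, h3]
    rw [e]; linarith

/-- The invariant of the reweighting loop after `j` rounds; `c` is the cube root of `m`, `N` the
number of narrow rounds, and `X` the sum of their solutions. -/
structure ReweightInv (pb : Problem d n m) (v w : Fin m → ℝ) (μ G c : ℝ) (j : ℕ)
    (r : Fin m → ℝ) (N e : ℝ) (X Δ : Fin n → ℝ) : Prop where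
  r_ge : ∀ i, 1 / (m : ℝ) ≤ r i
  stat : Stationary pb (qw μ G w r) v Δ
  e_eq : e = ∑ i, v i * (pb.P *ᵥ Δ) i
  count : ∃ W N' : ℕ, N = N' ∧ j = W + N' ∧
    ∀ D, pb.A *ᵥ D = 0 → ∑ i, v i * (pb.P *ᵥ D) i = G →
      9 / 2 * (∑ i, r i - 1) ≤ ∑ i, qw μ G w r i * (pb.P *ᵥ D) i ^ 2 ∧
      W * (9 / (2 * c)) ≤ ∑ i, qw μ G w r i * (pb.P *ᵥ D) i ^ 2
  sum_le : ∑ i, r i ≤ 4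
  memX : pb.A *ᵥ X = 0
  linX : ∑ i, v i * (pb.P *ᵥ X) i = N * G
  quadX : ∑ i, w i * (pb.P *ᵥ X) i ^ 2 ≤ 6 * G * N ^ 2
  supX : ∀ i, |μ * (pb.P *ᵥ X) i| ≤ 3 * N + 2 * (3 * c) * Real.log (m * r i)

section
variable {pb : Problem d n m} {v w : Fin m → ℝ} {μ G c : ℝ}

theorem ReweightInv.initial (hm : 0 < m) (hw : ∀ i, 0 ≤ w i) (hG : 0 < G)
    {Δ : Fin n → ℝ} (hΔ : Stationary pb (qw μ G w fun _ => 1 / (m : ℝ)) v Δ) :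
    ReweightInv pb v w μ G c 0 (fun _ => 1 / (m : ℝ)) 0 (∑ i, v i * (pb.P *ᵥ Δ) i) 0 Δ := by
  have hm' : (m : ℝ) ≠ 0 := by positivity
  have hs : ∑ _i : Fin m, 1 / (m : ℝ) = 1 := by simp [hm']
  have hq : ∀ i, 0 ≤ qw μ G w (fun _ => 1 / (m : ℝ)) i := fun i => by
    have := hw i; unfold qw; positivity
  refine ⟨fun _ => le_rfl, hΔ, rfl, ⟨0, 0, by simp, rfl, fun D _ _ => ?_⟩, by rw [hs]; norm_num,
    by simp, by simp, by simp, by simp [hm']⟩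
  have : 0 ≤ ∑ i, qw μ G w (fun _ => 1 / (m : ℝ)) i * (pb.P *ᵥ D) i ^ 2 :=
    Finset.sum_nonneg fun i _ => mul_nonneg (hq i) (sq_nonneg _)
  rw [hs]
  constructor <;> simpa using this

variable {j : ℕ} {r : Fin m → ℝ} {N e : ℝ} {X Δ : Fin n → ℝ}

theorem ReweightInv.r_pos (h : ReweightInv pb v w μ G c j r N e X Δ) (i : Fin m) : 0 < r i := by
  have : 0 < m := i.pos
  exact lt_of_lt_of_le (by positivity) (h.r_ge i)

theorem ReweightInv.step (hm : 0 < m) (hw : ∀ i, 0 ≤ w i) (hG : 0 < G) (hμ : 0 < μ)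
    (hc : 0 < c) (hcm : c ^ 3 = m) (h : ReweightInv pb v w μ G c j r N e X Δ)
    (hg : G ^ 2 ≤ (∑ i, r i + 1) * e) {u : Fin m → ℝ} (hu : u = fun i => μ * (G / e * (pb.P *ᵥ Δ) i))
    {Δ' : Fin n → ℝ}
    (hΔ' : Stationary pb (qw μ G w (reweight (3 * c) u r)) v Δ') :
    (j : ℝ) ≤ N + c ∧
    ReweightInv pb v w μ G c (j + 1) (reweight (3 * c) u r) (N + narrow (3 * c) u)
      (∑ i, v i * (pb.P *ᵥ Δ') i) (X + (narrow (3 * c) u * (G / e)) • Δ) Δ' := by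
  have hr := h.r_pos
  have hρ : 0 < 3 * c := by positivity
  have hm0 : (0 : ℝ) < m := by exact_mod_cast hm
  have hRpos : 0 < ∑ i, r i + 1 := by
    have : 0 ≤ ∑ i, r i := Finset.sum_nonneg fun i _ => (hr i).le
    linarith
  have he : 0 < e := pos_of_mul_pos_right ((pow_pos hG 2).trans_le hg) hRpos.le
  have hq : ∀ i, 0 < qw μ G w r i := fun i => by
    have := hw i; have := hr i; unfold qw; positivity
  set Y : Fin m → ℝ := fun i => G / e * (pb.P *ᵥ Δ) i with hY
  have hPY : pb.P *ᵥ ((G / e) • Δ) = Y := by rw [Matrix.mulVec_smul]; rfl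
  have hAY : pb.A *ᵥ ((G / e) • Δ) = 0 := by rw [Matrix.mulVec_smul, h.stat.mem, smul_zero]
  have hlY : ∑ i, v i * Y i = G := by
    have : ∑ i, v i * Y i = G / e * ∑ i, v i * (pb.P *ᵥ Δ) i := by
      rw [Finset.mul_sum]; exact Finset.sum_congr rfl fun i _ => by rw [hY]; ring
    rw [this, ← h.e_eq]; field_simp
  have hcross : ∀ D, pb.A *ᵥ D = 0 → ∑ i, v i * (pb.P *ᵥ D) i = G →
      ∑ i, qw μ G w r i * Y i * (pb.P *ᵥ D) i = G ^ 2 / e := fun D hD hl => by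
    have : ∑ i, qw μ G w r i * Y i * (pb.P *ᵥ D) i
        = G / e * ∑ i, qw μ G w r i * (pb.P *ᵥ Δ) i * (pb.P *ᵥ D) i := by
      rw [Finset.mul_sum]; exact Finset.sum_congr rfl fun i _ => by rw [hY]; ring
    rw [this, h.stat.eq D hD, hl]; ring
  have hE : ∑ i, qw μ G w r i * Y i ^ 2 = G ^ 2 / e := by
    have := hcross _ hAY (by rw [hPY]; exact hlY)
    rw [hPY] at this
    rw [← this]; exact Finset.sum_congr rfl fun i _ => by ring
  have hE1 : ∑ i, qw μ G w r i * Y i ^ 2 ≤ ∑ i, r i + 1 := by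
    rw [hE, div_le_iff₀ he]; exact hg
  obtain ⟨W, N', hN, hj, hen⟩ := h.count
  have henY := hen _ hAY (by rw [hPY]; exact hlY)
  rw [hPY] at henY
  have hR2 : ∑ i, r i ≤ 2 := by linarith [henY.1]
  have hE3 : ∑ i, qw μ G w r i * Y i ^ 2 ≤ 3 := by linarith
  have hW : (W : ℝ) ≤ c := by
    have h1 : (W : ℝ) * (9 / (2 * c)) ≤ 3 := henY.2.trans hE3
    rw [mul_div_assoc', div_le_iff₀ (by positivity)] at h1
    linarith
  have hNnn : 0 ≤ N := by rw [hN]; positivity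
  set r' := reweight (3 * c) u r with hr'
  have hrr' : ∀ i, r i ≤ r' i := le_reweight hρ hr
  have hr'2 : ∀ i, r' i ≤ 2 * r i := reweight_le hρ hr
  have huY : ∀ i, u i = μ * Y i := fun i => by rw [hu]
  have hinc : ∀ D, pb.A *ᵥ D = 0 → ∑ i, v i * (pb.P *ᵥ D) i = G →
      ∑ i, qw μ G w r i * Y i ^ 2 + 1 / 2 * ∑ i, (r' i - r i) * u i ^ 2
        ≤ ∑ i, qw μ G w r' i * (pb.P *ᵥ D) i ^ 2 := fun D hD hl => by
    have := energy_increase (q := qw μ G w r) (q' := qw μ G w r') (y := Y) (z := pb.P *ᵥ D) hq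
      (fun i => by
        unfold qw
        have := mul_le_mul_of_nonneg_left (hrr' i) (sq_nonneg μ)
        linarith)
      (fun i => by
        unfold qw
        have := mul_le_mul_of_nonneg_left (hr'2 i) (sq_nonneg μ)
        have : 0 ≤ w i / (2 * G) := by have := hw i; positivity
        linarith)
      (by rw [hcross D hD hl, hE])
    refine le_trans (le_of_eq ?_) this
    congr 2
    refine Finset.sum_congr rfl fun i _ => ?_
    rw [huY, qw, qw]; ring
  have hge9 : 9 * (∑ i, r' i - ∑ i, r i) ≤ ∑ i, (r' i - r i) * u i ^ 2 := by
    rw [← Finset.sum_sub_distrib, Finset.mul_sum]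
    exact Finset.sum_le_sum fun i _ => nine_mul_reweight_sub_le hρ hr i
  have hge0 : 0 ≤ ∑ i, (r' i - r i) * u i ^ 2 :=
    Finset.sum_nonneg fun i _ => mul_nonneg (sub_nonneg.2 (hrr' i)) (sq_nonneg _)
  have hsum' : ∑ i, r' i ≤ 4 := by
    have : ∑ i, r' i ≤ ∑ i, 2 * r i := Finset.sum_le_sum fun i _ => hr'2 i
    rw [← Finset.mul_sum] at this
    linarith
  have hr'ge : ∀ i, 1 / (m : ℝ) ≤ r' i := fun i => (h.r_ge i).trans (hrr' i)
  refine ⟨by rw [hj, hN]; push_cast; linarith, ?_⟩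
  by_cases hnar : ∀ i, |u i| < 3 * c
  · have e1 : narrow (3 * c) u = 1 := by simp [narrow, hnar]
    rw [e1, one_mul]
    have hPX : pb.P *ᵥ (X + (G / e) • Δ) = fun i => (pb.P *ᵥ X) i + Y i := by
      rw [Matrix.mulVec_add, hPY]; rfl
    refine ⟨hr'ge, hΔ', rfl, ⟨W, N' + 1, by push_cast; linarith, by omega, fun D hD hl => ?_⟩,
      hsum', ?_, ?_, ?_, ?_⟩
    · have := hinc D hD hl
      exact ⟨by linarith [henY.1], by linarith [henY.2]⟩
    · rw [Matrix.mulVec_add, h.memX, hAY, add_zero]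
    · rw [hPX]
      simp only [mul_add, Finset.sum_add_distrib]
      rw [h.linX, hlY]; ring
    · rw [hPX]
      have hwY : ∑ i, w i * Y i ^ 2 ≤ 6 * G := by
        have : ∑ i, w i * Y i ^ 2 ≤ 2 * G * ∑ i, qw μ G w r i * Y i ^ 2 := by
          rw [Finset.mul_sum]
          refine Finset.sum_le_sum fun i _ => ?_
          have e2 : 2 * G * (qw μ G w r i * Y i ^ 2)
            = 2 * G * (μ ^ 2 * r i * Y i ^ 2) + w i * Y i ^ 2 := by
            unfold qw; field_simp
          have : 0 ≤ 2 * G * (μ ^ 2 * r i * Y i ^ 2) := by have := hr i; positivity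
          linarith
        nlinarith
      have hpt : N * ∑ i, w i * ((pb.P *ᵥ X) i + Y i) ^ 2
          ≤ (N + 1) * (∑ i, w i * (pb.P *ᵥ X) i ^ 2 + N * ∑ i, w i * Y i ^ 2) := by
        rw [Finset.mul_sum, Finset.mul_sum (a := N), ← Finset.sum_add_distrib, Finset.mul_sum]
        refine Finset.sum_le_sum fun i _ => ?_
        have : 0 ≤ w i * ((pb.P *ᵥ X) i - N * Y i) ^ 2 := mul_nonneg (hw i) (sq_nonneg _)
        linarith
      rcases hNnn.eq_or_lt with h0 | hpos
      · have hX0 : ∑ i, w i * (pb.P *ᵥ X) i ^ 2 = 0 :=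
          le_antisymm (by simpa [← h0] using h.quadX)
            (Finset.sum_nonneg fun i _ => mul_nonneg (hw i) (sq_nonneg _))
        have hz : ∀ i, w i * (pb.P *ᵥ X) i ^ 2 = 0 := fun i =>
          (Finset.sum_eq_zero_iff_of_nonneg
            (fun i _ => mul_nonneg (hw i) (sq_nonneg _))).1 hX0 i (Finset.mem_univ i)
        have : ∑ i, w i * ((pb.P *ᵥ X) i + Y i) ^ 2 = ∑ i, w i * Y i ^ 2 := by
          refine Finset.sum_congr rfl fun i _ => ?_
          rcases mul_eq_zero.1 (hz i) with hh | hh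
          · rw [hh]; ring
          · rw [pow_eq_zero_iff (by norm_num)] at hh; rw [hh]; ring
        rw [this, ← h0]; linarith
      · have h3 : N * ∑ i, w i * ((pb.P *ᵥ X) i + Y i) ^ 2 ≤ N * (6 * G * (N + 1) ^ 2) := by
          refine hpt.trans ?_
          have : (N + 1) * (∑ i, w i * (pb.P *ᵥ X) i ^ 2 + N * ∑ i, w i * Y i ^ 2)
            ≤ (N + 1) * (6 * G * N ^ 2 + N * (6 * G)) := by gcongr; exact h.quadX
          refine this.trans (le_of_eq ?_); ring
        exact le_of_mul_le_mul_left h3 hpos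
    · intro i
      rw [hPX]
      simp only [mul_add]
      have h1 := abs_add_le (μ * (pb.P *ᵥ X) i) (μ * Y i)
      rw [← huY] at h1 ⊢
      have h2 := h.supX i
      have h3 := log_reweight hρ hr (hnar i) hm0
      linarith
  · have e0 : narrow (3 * c) u = 0 := by simp only [narrow, hnar, if_false]
    rw [e0, zero_mul, zero_smul, add_zero, add_zero]
    refine ⟨hr'ge, hΔ', rfl, ⟨W + 1, N', hN, by omega, fun D hD hl => ?_⟩, hsum', h.memX, h.linX,
      h.quadX, fun i => ?_⟩
    · have hD' := hinc D hD hl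
      refine ⟨by linarith [henY.1], ?_⟩
      push Not at hnar
      obtain ⟨i, hi⟩ := hnar
      have h1 : (r' i - r i) * u i ^ 2 ≤ ∑ i, (r' i - r i) * u i ^ 2 :=
        Finset.single_le_sum (f := fun i => (r' i - r i) * u i ^ 2)
          (fun i _ => mul_nonneg (sub_nonneg.2 (hrr' i)) (sq_nonneg _)) (Finset.mem_univ i)
      have hc1 : 1 ≤ c := by
        by_contra hlt
        have : c ^ 3 < 1 := pow_lt_one₀ hc.le (not_le.1 hlt) (by norm_num)
        rw [hcm] at this
        have : (1 : ℝ) ≤ m := by exact_mod_cast hm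
        linarith
      have h2 : r' i - r i = r i := by
        have : (3 : ℝ) ≤ |u i| := by linarith
        simp [hr', reweight, hi, this]; ring
      have h3 : (3 * c) ^ 2 ≤ u i ^ 2 := by rw [← sq_abs (u i)]; gcongr
      have h4 : 9 / c ≤ (r' i - r i) * u i ^ 2 := by
        rw [h2]
        calc 9 / c = 1 / (m : ℝ) * (3 * c) ^ 2 := by rw [← hcm]; field_simp; norm_num
          _ ≤ r i * u i ^ 2 := mul_le_mul (h.r_ge i) h3 (by positivity) (hr i).le
      have h5 : ((W + 1 : ℕ) : ℝ) * (9 / (2 * c)) = W * (9 / (2 * c)) + 1 / 2 * (9 / c) := by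
        push_cast; field_simp
      rw [h5]
      linarith [henY.2]
    · refine (h.supX i).trans ?_
      have : Real.log (m * r i) ≤ Real.log (m * r' i) :=
        Real.log_le_log (mul_pos hm0 (hr i)) (by have := hrr' i; gcongr)
      have := mul_le_mul_of_nonneg_left this (show 0 ≤ 2 * (3 * c) by positivity)
      linarith

/-- If the loop ends early, there is no direction of the required quality. -/
theorem ReweightInv.infeasible (hG : 0 < G) (hμ : 0 < μ) (hw : ∀ i, 0 ≤ w i)
    (h : ReweightInv pb v w μ G c j r N e X Δ)
    (hg : ¬ G ^ 2 ≤ (∑ i, r i + 1) * e) {D : Fin n → ℝ} (hD : pb.A *ᵥ D = 0)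
    (hl : ∑ i, v i * (pb.P *ᵥ D) i = G) (hsup : ∀ i, μ * |(pb.P *ᵥ D) i| ≤ 1)
    (hquad : ∑ i, w i * (pb.P *ᵥ D) i ^ 2 ≤ 2 * G) : False := by
  have hr := h.r_pos
  have hq : ∀ i, 0 ≤ qw μ G w r i := fun i => by
    have := hw i; have := hr i; unfold qw; positivity
  set z := pb.P *ᵥ D
  set y := pb.P *ᵥ Δ
  have h1 : ∑ i, qw μ G w r i * y i * z i = G := by rw [h.stat.eq D hD, hl]
  have h2 : ∑ i, qw μ G w r i * y i ^ 2 = e := by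
    have := h.stat.eq Δ h.stat.mem
    rw [← h.e_eq] at this
    rw [← this]; exact Finset.sum_congr rfl fun i _ => by ring
  have h3 : ∑ i, qw μ G w r i * z i ^ 2 ≤ ∑ i, r i + 1 := by
    have e1 : ∑ i, qw μ G w r i * z i ^ 2
        = ∑ i, r i * (μ * |z i|) ^ 2 + (∑ i, w i * z i ^ 2) / (2 * G) := by
      rw [Finset.sum_div, ← Finset.sum_add_distrib]
      refine Finset.sum_congr rfl fun i _ => ?_
      rw [mul_pow, sq_abs, qw]; ring
    rw [e1]
    refine add_le_add (Finset.sum_le_sum fun i _ => ?_) ?_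
    · have : (μ * |z i|) ^ 2 ≤ 1 := pow_le_one₀ (by positivity) (hsup i)
      have := hr i
      nlinarith
    · rw [div_le_one (by positivity)]; exact hquad
  have hcs : (∑ i, qw μ G w r i * y i * z i) ^ 2
      ≤ (∑ i, qw μ G w r i * y i ^ 2) * ∑ i, qw μ G w r i * z i ^ 2 :=
    Finset.sum_sq_le_sum_mul_sum_of_sq_le_mul _ (fun i _ => mul_nonneg (hq i) (sq_nonneg _))
      (fun i _ => mul_nonneg (hq i) (sq_nonneg _)) (fun i _ => le_of_eq (by ring))
  rw [h1, h2] at hcs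
  have he : 0 ≤ e := by
    rw [← h2]; exact Finset.sum_nonneg fun i _ => mul_nonneg (hq i) (sq_nonneg _)
  exact hg (hcs.trans (by rw [mul_comm]; gcongr))

/-- If the loop finds enough narrow solutions, their average has small coordinates. -/
theorem ReweightInv.sup_le (hm : 0 < m) (hc : 0 < c) (h : ReweightInv pb v w μ G c j r N e X Δ)
    (hN : 6 * c * Real.log (4 * m) < N) (i : Fin m) : |μ * (pb.P *ᵥ X) i| ≤ 4 * N := by
  have hm0 : (0 : ℝ) < m := by exact_mod_cast hm
  have hr4 : r i ≤ 4 :=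
    (Finset.single_le_sum (f := r) (fun i _ => (h.r_pos i).le) (Finset.mem_univ i)).trans h.sum_le
  have : Real.log (m * r i) ≤ Real.log (4 * m) :=
    Real.log_le_log (mul_pos hm0 (h.r_pos i)) (by rw [mul_comm]; gcongr)
  have := mul_le_mul_of_nonneg_left this (show 0 ≤ 2 * (3 * c) by positivity)
  linarith [h.supX i]

end
end QSC

namespace QSC
variable {d n m : ℕ}

/-! ### Progress of a step -/

section progress
variable {pb : Problem d n m} {φ φ₁ φ₂ φ₃ : ℝ → ℝ} {μ G c : ℝ} {x : Fin n → ℝ}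

/-- A successful search for a direction yields a decrease by `G / 36`. -/
theorem ReweightInv.decrease (hφ : QSCDeriv φ φ₁ φ₂ φ₃ μ) (hm : 0 < m) (hc : 0 < c) {j : ℕ}
    {r : Fin m → ℝ} {N e : ℝ} {X Δ : Fin n → ℝ}
    (h : ReweightInv pb (fun i => -φ₁ ((pb.P *ᵥ x) i)) (fun i => φ₂ ((pb.P *ᵥ x) i)) μ G c j r N e
      X Δ)
    (hN : 6 * c * Real.log (4 * m) < N) :
    ∑ i, φ ((pb.P *ᵥ (x + (1 / (18 * N)) • X)) i) ≤ ∑ i, φ ((pb.P *ᵥ x) i) - G / 36 := by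
  have hN0 : 0 < N := by
    have : (1 : ℝ) ≤ m := by exact_mod_cast hm
    have : 0 ≤ Real.log (4 * m) := Real.log_nonneg (by linarith)
    exact lt_of_le_of_lt (by positivity) hN
  set t := 1 / (18 * N) with ht
  have ht0 : 0 < t := by positivity
  have htN : t * N = 1 / 18 := by rw [ht]; field_simp
  have hP : ∀ i, (pb.P *ᵥ (x + t • X)) i = (pb.P *ᵥ x) i + t * (pb.P *ᵥ X) i := fun i => by
    rw [Matrix.mulVec_add, Matrix.mulVec_smul]; rfl
  have hb : ∀ i, φ ((pb.P *ᵥ (x + t • X)) i) ≤ φ ((pb.P *ᵥ x) i)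
      - t * (-φ₁ ((pb.P *ᵥ x) i) * (pb.P *ᵥ X) i)
      + 3 / 2 * t ^ 2 * (φ₂ ((pb.P *ᵥ x) i) * (pb.P *ᵥ X) i ^ 2) := fun i => by
    rw [hP]
    refine (hφ.le_quadratic ?_).trans (le_of_eq (by ring))
    have := h.sup_le hm hc hN i
    rw [abs_mul, abs_of_pos hφ.pos] at this
    rw [abs_mul, abs_of_pos ht0]
    have := mul_le_mul_of_nonneg_left this ht0.le
    nlinarith
  refine (Finset.sum_le_sum fun i _ => hb i).trans ?_
  rw [Finset.sum_add_distrib, Finset.sum_sub_distrib, ← Finset.mul_sum, ← Finset.mul_sum, h.linX]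
  have := mul_le_mul_of_nonneg_left h.quadX (show 0 ≤ 3 / 2 * t ^ 2 by positivity)
  have e : 3 / 2 * t ^ 2 * (6 * G * N ^ 2) = 9 * G * (t * N) ^ 2 := by ring
  rw [e, htN] at this
  rw [← mul_assoc, htN]
  linarith

/-- If there is no direction of the required quality, then `x` is almost as good as `y`. -/
theorem gap_le_of_infeasible (hφ : QSCDeriv φ φ₁ φ₂ φ₃ μ) (hG : 0 < G) {y : Fin n → ℝ}
    (hinf : ∀ D, pb.A *ᵥ D = 0 → ∑ i, -φ₁ ((pb.P *ᵥ x) i) * (pb.P *ᵥ D) i = G →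
      (∀ i, μ * |(pb.P *ᵥ D) i| ≤ 1) →
      ∑ i, φ₂ ((pb.P *ᵥ x) i) * (pb.P *ᵥ D) i ^ 2 ≤ 2 * G → False)
    (hA : pb.A *ᵥ y = pb.A *ᵥ x) {θ : ℝ} (h0 : 0 ≤ θ) (h1 : θ ≤ 1)
    (hθ : ∀ i, μ * (θ * |(pb.P *ᵥ y) i - (pb.P *ᵥ x) i|) ≤ 1) :
    θ * (∑ i, φ ((pb.P *ᵥ x) i) - ∑ i, φ ((pb.P *ᵥ y) i)) ≤ G := by
  by_contra hlt
  push Not at hlt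
  set z : Fin m → ℝ := fun i => (pb.P *ᵥ y) i - (pb.P *ᵥ x) i with hz
  set s := ∑ i, -φ₁ ((pb.P *ᵥ x) i) * (θ * z i) with hs
  set Q := ∑ i, φ₂ ((pb.P *ᵥ x) i) * (θ * z i) ^ 2 with hQ
  have hsQ : G < s - 1 / 6 * Q := by
    have hi : ∀ i, -(-φ₁ ((pb.P *ᵥ x) i) * (θ * z i))
        + 1 / 6 * (φ₂ ((pb.P *ᵥ x) i) * (θ * z i) ^ 2)
        ≤ θ * (φ ((pb.P *ᵥ y) i) - φ ((pb.P *ᵥ x) i)) := fun i => by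
      have a1 := hφ.quadratic_le (t := (pb.P *ᵥ x) i) (u := θ * z i)
        (by rw [abs_mul, abs_of_nonneg h0]; exact hθ i)
      have a2 := hφ.convex h0 h1 ((pb.P *ᵥ x) i) (z i)
      rw [show (pb.P *ᵥ x) i + z i = (pb.P *ᵥ y) i by rw [hz]; ring] at a2
      linarith
    have := Finset.sum_le_sum fun i (_ : i ∈ Finset.univ) => hi i
    rw [Finset.sum_add_distrib, Finset.sum_neg_distrib, ← Finset.mul_sum, ← Finset.mul_sum,
      Finset.sum_sub_distrib] at this
    linarith
  have hQ0 : 0 ≤ Q := Finset.sum_nonneg fun i _ => mul_nonneg (hφ.nonneg _) (sq_nonneg _)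
  have hsG : G < s := by linarith
  have hs0 : 0 < s := hG.trans hsG
  set t := G / s with ht
  have ht0 : 0 < t := div_pos hG hs0
  have ht1 : t ≤ 1 := by rw [ht, div_le_one hs0]; exact hsG.le
  have hPD : ∀ i, (pb.P *ᵥ ((t * θ) • (y - x))) i = t * (θ * z i) := fun i => by
    rw [Matrix.mulVec_smul, Matrix.mulVec_sub, Pi.smul_apply, Pi.sub_apply, smul_eq_mul, hz]
    ring
  refine hinf ((t * θ) • (y - x)) ?_ ?_ (fun i => ?_) ?_
  · rw [Matrix.mulVec_smul, Matrix.mulVec_sub, hA, sub_self, smul_zero]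
  · have : ∑ i, -φ₁ ((pb.P *ᵥ x) i) * (t * (θ * z i)) = t * s := by
      rw [hs, Finset.mul_sum]; exact Finset.sum_congr rfl fun i _ => by ring
    simp only [hPD]
    rw [this, ht]; field_simp
  · rw [hPD, abs_mul, abs_mul, abs_of_pos ht0, abs_of_nonneg h0]
    have hi := hθ i
    have hn : 0 ≤ μ * (θ * |z i|) := by have := hφ.pos; positivity
    have : μ * (t * (θ * |z i|)) = t * (μ * (θ * |z i|)) := by ring
    rw [this]
    exact (mul_le_of_le_one_left hn ht1).trans hi
  · have : ∑ i, φ₂ ((pb.P *ᵥ x) i) * (t * (θ * z i)) ^ 2 = t ^ 2 * Q := by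
      rw [hQ, Finset.mul_sum]; exact Finset.sum_congr rfl fun i _ => by ring
    simp only [hPD]
    rw [this, ht, div_pow, div_mul_eq_mul_div, div_le_iff₀ (by positivity)]
    have : Q ≤ 6 * (s - G) := by linarith
    have : G * Q ≤ 2 * s ^ 2 := by
      nlinarith [mul_le_mul_of_nonneg_left this hG.le, sq_nonneg (s - 2 * G), sq_nonneg s, mul_pos hG hs0,
        sq_nonneg (s - G), sq_nonneg (2 * s - 3 * G)]
    nlinarith

end progress

/-! ### The regularized objective -/

/-- The growth rate of the regularizer. -/
noncomputable def rate (m : ℕ) (M R : ℝ) : ℝ := 2 * Real.log (1728 * m * (2 + M * R))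

/-- The self-concordance constant of the regularized objective. -/
noncomputable def conc (m : ℕ) (M R : ℝ) : ℝ := M + rate m M R / R

/-- The bound for the ratio of the gap to the scale. -/
noncomputable def ratio (m : ℕ) (M R : ℝ) : ℝ := 6 * (M * R + rate m M R) + 4

noncomputable def surrogate (pb : Problem d n m) (L R G : ℝ) (x : Fin n → ℝ) : ℝ :=
  ∑ i, (pb.f ((pb.P *ᵥ x) i) + G / (144 * m) * barrier L R ((pb.P *ᵥ x) i))

noncomputable def negGrad (pb : Problem d n m) (L R G : ℝ) (x : Fin n → ℝ) : Fin m → ℝ := fun i =>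
  -(iteratedDeriv 1 pb.f ((pb.P *ᵥ x) i) + G / (144 * m) * barrier₁ L R ((pb.P *ᵥ x) i))

noncomputable def hess (pb : Problem d n m) (L R G : ℝ) (x : Fin n → ℝ) : Fin m → ℝ := fun i =>
  iteratedDeriv 2 pb.f ((pb.P *ᵥ x) i) + G / (144 * m) * barrier₂ L R ((pb.P *ᵥ x) i)

theorem surrogate_eq (pb : Problem d n m) (L R G : ℝ) (x : Fin n → ℝ) :
    surrogate pb L R G x
      = pb.objective x + G / (144 * m) * ∑ i, barrier L R ((pb.P *ᵥ x) i) := by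
  rw [surrogate, Finset.sum_add_distrib, ← Finset.mul_sum]; rfl

/-- The hypotheses on the instance. -/
structure Admissible (pb : Problem d n m) (M R : ℝ) (xstar : Fin n → ℝ) : Prop where
  hm : 0 < m
  qsc : IsQuasiSelfConcordant pb.f M
  hR : 0 < R
  opt : pb.IsOptimal xstar
  le : ∀ i, |(pb.P *ᵥ xstar) i| ≤ R

namespace Admissible
variable {pb : Problem d n m} {M R : ℝ} {xs : Fin n → ℝ}

theorem one_le_m (h : Admissible pb M R xs) : (1 : ℝ) ≤ m := by exact_mod_cast h.hm

theorem mr_pos (h : Admissible pb M R xs) : 0 < M * R := mul_pos h.qsc.1 h.hR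

theorem rate_arg (h : Admissible pb M R xs) : 1 < 1728 * m * (2 + M * R) := by
  nlinarith [h.one_le_m, h.mr_pos]

theorem rate_pos (h : Admissible pb M R xs) : 0 < rate m M R :=
  mul_pos two_pos (Real.log_pos h.rate_arg)

theorem conc_mul (h : Admissible pb M R xs) : conc m M R * R = M * R + rate m M R := by
  have := h.hR.ne'
  rw [conc]; field_simp

theorem conc_pos (h : Admissible pb M R xs) : 0 < conc m M R :=
  add_pos h.qsc.1 (div_pos h.rate_pos h.hR)

theorem ratio_pos (h : Admissible pb M R xs) : 4 < ratio m M R := by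
  unfold ratio; linarith [h.mr_pos, h.rate_pos]

theorem qscDeriv (h : Admissible pb M R xs) {G : ℝ} (hG : 0 ≤ G) :
    ∃ φ₃, QSCDeriv (fun t => pb.f t + G / (144 * m) * barrier (rate m M R) R t)
      (fun t => iteratedDeriv 1 pb.f t + G / (144 * m) * barrier₁ (rate m M R) R t)
      (fun t => iteratedDeriv 2 pb.f t + G / (144 * m) * barrier₂ (rate m M R) R t) φ₃
      (conc m M R) :=
  h.qsc.qscDeriv.add_barrier h.rate_pos h.hR (by positivity)

theorem hess_nonneg (h : Admissible pb M R xs) {G : ℝ} (hG : 0 ≤ G) (x : Fin n → ℝ) (i : Fin m) :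
    0 ≤ hess pb (rate m M R) R G x i := by
  obtain ⟨_, hφ⟩ := h.qscDeriv hG
  exact hφ.nonneg _

theorem surrogate_le (h : Admissible pb M R xs) {G : ℝ} (hG : 0 ≤ G) {x : Fin n → ℝ}
    (hx : ∀ i, |(pb.P *ᵥ x) i| ≤ R) :
    surrogate pb (rate m M R) R G x ≤ pb.objective x + G / 72 := by
  have hm0 : (0 : ℝ) < m := by linarith [h.one_le_m]
  have : ∑ i, barrier (rate m M R) R ((pb.P *ᵥ x) i) ≤ ∑ _i : Fin m, (2 : ℝ) :=
    Finset.sum_le_sum fun i _ => barrier_le_two h.rate_pos.le h.hR (hx i)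
  rw [Finset.sum_const, Finset.card_univ, Fintype.card_fin, nsmul_eq_mul] at this
  have := mul_le_mul_of_nonneg_left this (show 0 ≤ G / (144 * m) by positivity)
  have e : G / (144 * m) * (m * 2) = G / 72 := by field_simp; ring
  rw [surrogate_eq]; linarith

theorem objective_le_surrogate {G : ℝ} (hG : 0 ≤ G) (L : ℝ) (x : Fin n → ℝ) :
    pb.objective x ≤ surrogate pb L R G x := by
  rw [surrogate_eq]
  have : 0 ≤ G / (144 * m) * ∑ i, barrier L R ((pb.P *ᵥ x) i) :=
    mul_nonneg (by positivity) (Finset.sum_nonneg fun i _ => (barrier_pos _ _ _).le)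
  linarith

theorem surrogate_mono {G G' : ℝ} (hGG : G ≤ G') (L : ℝ) (x : Fin n → ℝ) :
    surrogate pb L R G x ≤ surrogate pb L R G' x := by
  rw [surrogate_eq, surrogate_eq]
  have : 0 ≤ ∑ i, barrier L R ((pb.P *ᵥ x) i) :=
    Finset.sum_nonneg fun i _ => (barrier_pos _ _ _).le
  gcongr

theorem exp_rate_ge (h : Admissible pb M R xs) :
    144 * m * ratio m M R ≤ Real.exp (rate m M R) := by
  have hm := h.one_le_m
  set L := rate m M R with hL
  set B := 1728 * m * (2 + M * R) with hB
  have hB0 : 0 < B := lt_trans zero_lt_one h.rate_arg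
  have e1 : Real.exp (L / 2) = B := by
    rw [hL, rate, mul_div_cancel_left₀ _ two_ne_zero, Real.exp_log hB0]
  have e2 : Real.exp L = B * Real.exp (L / 2) := by
    rw [← e1, ← Real.exp_add]; ring_nf
  have e3 : L / 2 + 1 ≤ Real.exp (L / 2) := Real.add_one_le_exp _
  rw [e2]
  refine le_trans ?_ (mul_le_mul_of_nonneg_left e3 hB0.le)
  rw [hB, ratio]
  have h1 := h.mr_pos
  have h2 : 0 < L := h.rate_pos
  have : 6 * (M * R + L) + 4 ≤ 12 * (2 + M * R) * (L / 2 + 1) := by nlinarith [mul_pos h1 h2]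
  have := mul_le_mul_of_nonneg_left this (show 0 ≤ 144 * (m : ℝ) by positivity)
  linarith

/-- Points with a small gap are in a box of twice the size. -/
theorem abs_le_of_surrogate (h : Admissible pb M R xs) {G : ℝ} (hG : 0 < G) {x : Fin n → ℝ}
    (hA : pb.A *ᵥ x = pb.b)
    (hx : surrogate pb (rate m M R) R G x - pb.objective xs ≤ ratio m M R * G) (i : Fin m) :
    |(pb.P *ᵥ x) i| ≤ 2 * R := by
  have hm0 : (0 : ℝ) < m := by linarith [h.one_le_m]
  have hopt := h.opt.2 x hA
  rw [surrogate_eq] at hx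
  have h1 : G / (144 * m) * ∑ i, barrier (rate m M R) R ((pb.P *ᵥ x) i) ≤ ratio m M R * G := by
    linarith
  have h2 : barrier (rate m M R) R ((pb.P *ᵥ x) i)
      ≤ ∑ i, barrier (rate m M R) R ((pb.P *ᵥ x) i) :=
    Finset.single_le_sum (f := fun i => barrier (rate m M R) R ((pb.P *ᵥ x) i))
      (fun i _ => (barrier_pos _ _ _).le) (Finset.mem_univ i)
  have h3 : ∑ i, barrier (rate m M R) R ((pb.P *ᵥ x) i) ≤ 144 * m * ratio m M R := by
    have e : G / (144 * m) * (144 * m * ratio m M R) = ratio m M R * G := by field_simp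
    rw [← e] at h1
    exact le_of_mul_le_mul_left h1 (by positivity)
  have h4 := (exp_le_barrier _ _ _).trans (h2.trans (h3.trans h.exp_rate_ge))
  have h5 := le_of_mul_le_mul_left ((Real.exp_le_exp.1 h4).trans (mul_one _).ge) h.rate_pos
  have : |(pb.P *ᵥ x) i| / R ≤ 2 := by linarith
  rwa [div_le_iff₀ h.hR] at this

variable {G c : ℝ} {x : Fin n → ℝ} {j : ℕ} {r : Fin m → ℝ} {N e : ℝ} {X Δ : Fin n → ℝ}

theorem success (h : Admissible pb M R xs) (hG : 0 < G) (hc : 0 < c) (hA : pb.A *ᵥ x = pb.b)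
    (hI : ReweightInv pb (negGrad pb (rate m M R) R G x) (hess pb (rate m M R) R G x)
      (conc m M R) G c j r N e X Δ) (hN : 6 * c * Real.log (4 * m) < N) :
    pb.A *ᵥ (x + (1 / (18 * N)) • X) = pb.b ∧
    surrogate pb (rate m M R) R G (x + (1 / (18 * N)) • X)
      ≤ surrogate pb (rate m M R) R G x - G / 36 := by
  obtain ⟨_, hφ⟩ := h.qscDeriv hG.le
  refine ⟨?_, ReweightInv.decrease hφ h.hm hc hI hN⟩
  rw [Matrix.mulVec_add, Matrix.mulVec_smul, hI.memX, hA, smul_zero, add_zero]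

theorem failure (h : Admissible pb M R xs) (hG : 0 < G) (hA : pb.A *ᵥ x = pb.b)
    (hx : ∀ i, |(pb.P *ᵥ x) i| ≤ 2 * R)
    (hI : ReweightInv pb (negGrad pb (rate m M R) R G x) (hess pb (rate m M R) R G x)
      (conc m M R) G c j r N e X Δ) (hg : ¬ G ^ 2 ≤ (∑ i, r i + 1) * e) :
    surrogate pb (rate m M R) R G x - pb.objective xs ≤ ratio m M R / 2 * G := by
  obtain ⟨_, hφ⟩ := h.qscDeriv hG.le
  have hK : 0 < 3 * (conc m M R * R) + 1 := by
    have := mul_pos h.conc_pos h.hR; positivity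
  have := gap_le_of_infeasible (pb := pb) (x := x) (y := xs) hφ hG
    (fun D hD hl hs hq => hI.infeasible hG h.conc_pos (h.hess_nonneg hG.le x) hg hD hl hs hq)
    (h.opt.1.trans hA.symm) (θ := 1 / (3 * (conc m M R * R) + 1)) (by positivity)
    (by rw [div_le_one hK]; have := mul_pos h.conc_pos h.hR; linarith)
    (fun i => by
      have h1 : |(pb.P *ᵥ xs) i - (pb.P *ᵥ x) i| ≤ 3 * R :=
        (abs_sub _ _).trans (by linarith [h.le i, hx i])
      have h2 := mul_le_mul_of_nonneg_left h1 h.conc_pos.le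
      rw [show ∀ a b k : ℝ, a * (1 / k * b) = a * b / k from fun a b k => by ring, div_le_one hK]
      linarith)
  rw [div_mul_eq_mul_div, one_mul, div_le_iff₀ hK] at this
  have hs := h.surrogate_le hG.le h.le
  have e : ratio m M R / 2 * G = G * (3 * (conc m M R * R) + 1) + G := by
    rw [h.conc_mul, ratio]; ring
  have e2 : surrogate pb (rate m M R) R G x - surrogate pb (rate m M R) R G xs
      ≤ G * (3 * (conc m M R * R) + 1) := this
  rw [e]; linarith

end Admissible
end QSC

namespace QSC
variable {d n m : ℕ}

/-! ### The program

Scalar registers: `3` rate, `4` self-concordance constant, `5` scale, `6` cube root of `m`,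
`7` number of narrow rounds needed, `8` ratio, `9` number of narrow rounds, `10` energy, `11` success
flag, `12` dimension, `13` narrowness of a round. Registers `prim`: `0` current point, `1` sum of the
narrow solutions, `2` solution, `3` candidate. Registers `rows`: `0` negative gradient, `1` Hessian,
`2` weights, `3` scaled coordinates of the solution, `4` their absolute values. -/

namespace Expr

abbrev S (i : ℕ) : Expr .scal := .var .scal i
abbrev V (i : ℕ) : Expr .prim := .var .prim i
abbrev W (i : ℕ) : Expr .rows := .var .rows i
abbrev up (a : Expr .scal) : Expr .rows := .bcast .rows a

/-- The two exponentials of the regularizer. -/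
def expRight : Expr .rows := .exp (up (S 3) * (.mulP (V 0) / up (S 1) - up (.const 1)))
def expLeft : Expr .rows :=
  .exp (up (S 3) * ((up (.const 0) - .mulP (V 0)) / up (S 1) - up (.const 1)))

def negGrad : Expr .rows :=
  up (.const 0) - (.loss 1 (.mulP (V 0)) +
    up (S 5 / (.const 144 * S 12)) * (up (S 3 / S 1) * (expRight - expLeft)))

def hess : Expr .rows :=
  .loss 2 (.mulP (V 0)) +
    up (S 5 / (.const 144 * S 12)) * (up ((S 3 / S 1) * (S 3 / S 1)) * (expRight + expLeft))

def weights : Expr .rows := up (S 4 * S 4) * W 2 + W 1 / up (.const 2 * S 5)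

def energy : Expr .scal := .sum (W 0 * .mulP (V 2))

def abs : Expr .rows := W 3 * (up (.const 2) * .le (up (.const 0)) (W 3) - up (.const 1))

def narrow : Expr .scal :=
  .const 1 - .le (.const 1) (.sum (.le (up (.const 3 * S 6)) (W 4)))

def reweight : Expr .rows :=
  W 2 * (up (.const 1) + .le (up (.const 3)) (W 4) *
    (.le (up (.const 3 * S 6)) (W 4) +
      (up (.const 1) - .le (up (.const 3 * S 6)) (W 4)) * (W 4 / up (.const 3 * S 6))))

/-- `1` while the energy is small and the narrow rounds are too few. -/
def goOn : Expr .scal :=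
  .le (S 5 * S 5) ((.sum (W 2) + .const 1) * S 10) * .le (S 9) (S 7)

end Expr

namespace Prog
open _root_.QSC.Expr

/-- One round of reweighting. -/
def round : Prog :=
  .seq (.assign .rows 3 (up (S 4) * (up (S 5 / S 10) * .mulP (V 2)))) <|
  .seq (.assign .rows 4 Expr.abs) <|
  .seq (.assign .scal 13 Expr.narrow) <|
  .seq (.assign .prim 1 (V 1 + .bcast .prim (S 13 * (S 5 / S 10)) * V 2)) <|
  .seq (.assign .scal 9 (S 9 + S 13)) <|
  .seq (.assign .rows 2 Expr.reweight) <|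
  .seq (.solve 2 Expr.weights (.mulPT (W 0))) <|
  .assign .scal 10 Expr.energy

/-- The search for a direction of progress at the scale in register `5`. -/
def search : Prog :=
  .seq (.assign .rows 0 Expr.negGrad) <|
  .seq (.assign .rows 1 Expr.hess) <|
  .seq (.assign .rows 2 (up (.const 1 / S 12))) <|
  .seq (.assign .scal 9 (.const 0)) <|
  .seq (.assign .prim 1 (.bcast .prim (.const 0))) <|
  .seq (.solve 2 Expr.weights (.mulPT (W 0))) <|
  .seq (.assign .scal 10 Expr.energy) <|
  .seq (.loop (.const 1) goOn round) <|
  .seq (.assign .scal 11 (.const 1 - .le (S 9) (S 7))) <|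
  .assign .prim 3 (V 0 + .bcast .prim (.const 1 / (.const 18 * S 9)) * V 1)

/-- The parameters. -/
def setup : Prog :=
  .seq (.assign .scal 12 (.sum (up (.const 1)))) <|
  .seq (.assign .scal 3 (.const 2 * .log (.const 1728 * S 12 * (.const 2 + S 0 * S 1)))) <|
  .seq (.assign .scal 4 (S 0 + S 3 / S 1)) <|
  .seq (.assign .scal 5 (S 2)) <|
  .seq (.assign .scal 6 (.exp (.log (S 12) / .const 3))) <|
  .seq (.assign .scal 7 (.const 6 * S 6 * .log (.const 4 * S 12))) <|
  .assign .scal 8 (.const 6 * (S 0 * S 1 + S 3) + .const 4)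

/-- Doubling of the scale until the search fails at the starting point. -/
def raise : Prog :=
  .seq search <| .loop (.const 1) (S 11) (.seq (.assign .scal 5 (.const 2 * S 5)) search)

/-- Descent, with the scale halved whenever the search fails. -/
def descend : Prog :=
  .loop (S 2) (S 8 * S 5) <| .seq search <|
    .branch (.const 1) (S 11) (.assign .prim 0 (V 3)) (.assign .scal 5 (S 5 / .const 2))

def main : Prog := .seq setup (.seq raise descend)

end Prog

/-! ### The search -/

/-- The number of narrow rounds that are needed. -/
noncomputable def rounds (m : ℕ) : ℝ :=
  6 * Real.exp (Real.log m / 3) * Real.log (4 * m)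

/-- The registers outside the search, with the scale `G` and the current point `x`. -/
structure Ready (M R ε G : ℝ) (x : Fin n → ℝ) (s : Store n m) : Prop where
  s0 : s.sc 0 = M
  s1 : s.sc 1 = R
  s2 : s.sc 2 = ε
  s3 : s.sc 3 = rate m M R
  s4 : s.sc 4 = conc m M R
  s5 : s.sc 5 = G
  s6 : s.sc 6 = Real.exp (Real.log m / 3)
  s7 : s.sc 7 = rounds m
  s8 : s.sc 8 = ratio m M R
  s12 : s.sc 12 = m
  p0 : s.pr 0 = x

section
variable {pb : Problem d n m} {S : SolverMap d n} {M R ε G : ℝ} {xs x : Fin n → ℝ} {s : Store n m}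

theorem Ready.negGrad (h : Ready M R ε G x s) :
    Expr.negGrad.vecR s pb = negGrad pb (rate m M R) R G x := by
  funext i
  simp [Expr.negGrad, Expr.expRight, Expr.expLeft, QSC.negGrad, barrier₁, h.s1, h.s3, h.s5, h.s12,
    h.p0]

theorem Ready.hess (h : Ready M R ε G x s) :
    Expr.hess.vecR s pb = hess pb (rate m M R) R G x := by
  funext i
  simp [Expr.hess, Expr.expRight, Expr.expLeft, QSC.hess, barrier₂, barrier, h.s1, h.s3, h.s5,
    h.s12, h.p0, sq]

theorem vecR_weights {w r : Fin m → ℝ} {μ : ℝ} (h4 : s.sc 4 = μ) (h5 : s.sc 5 = G)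
    (h1 : s.ro 1 = w) (h2 : s.ro 2 = r) : Expr.weights.vecR s pb = qw μ G w r := by
  funext i
  simp [Expr.weights, qw, h4, h5, h1, h2, sq]

theorem vecR_abs {u : Fin m → ℝ} (h : s.ro 3 = u) : Expr.abs.vecR s pb = fun i => |u i| := by
  funext i
  simp only [Expr.abs, vecR_mul, vecR_var, vecR_sub, vecR_bcast, val_const, vecR_le, h,
    Pi.mul_apply, Pi.sub_apply]
  split_ifs with h0
  · rw [abs_of_nonneg (by simpa using h0)]; norm_num
  · rw [abs_of_neg (by simpa using h0)]; norm_num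

theorem val_narrow {u : Fin m → ℝ} {c : ℝ} (h : s.ro 4 = fun i => |u i|) (h6 : s.sc 6 = c) :
    Expr.narrow.val pb s = narrow (3 * c) u := by
  classical
  have e : ∑ i, (if 3 * c ≤ |u i| then (1 : ℝ) else 0)
      = ((Finset.univ.filter fun i => 3 * c ≤ |u i|).card : ℝ) := by
    rw [Finset.sum_boole]
  simp only [Expr.narrow, val_sub, val_const, val_le, val_sumR, vecR_le, vecR_bcast, val_mul,
    val_var, vecR_var, h, h6, Rat.cast_one, Rat.cast_ofNat, e, narrow]
  by_cases hn : ∀ i, |u i| < 3 * c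
  · have : (Finset.univ.filter fun i => 3 * c ≤ |u i|) = ∅ :=
      Finset.filter_eq_empty_iff.2 fun i _ => not_le.2 (hn i)
    rw [if_pos hn, this]; norm_num
  · rw [if_neg hn]
    push Not at hn
    obtain ⟨i, hi⟩ := hn
    have : 0 < (Finset.univ.filter fun i => 3 * c ≤ |u i|).card :=
      Finset.card_pos.2 ⟨i, by simpa using hi⟩
    have : (1 : ℝ) ≤ ((Finset.univ.filter fun i => 3 * c ≤ |u i|).card : ℝ) := by exact_mod_cast this
    rw [if_pos this]; norm_num

theorem vecR_reweight {u r : Fin m → ℝ} {c : ℝ} (h : s.ro 4 = fun i => |u i|) (h6 : s.sc 6 = c)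
    (h2 : s.ro 2 = r) : Expr.reweight.vecR s pb = reweight (3 * c) u r := by
  funext i
  simp only [Expr.reweight, reweight, vecR_mul, vecR_add, vecR_sub, vecR_div, vecR_le, vecR_bcast,
    val_const, val_mul, val_var, vecR_var, h, h6, h2, Pi.mul_apply, Pi.add_apply, Pi.sub_apply,
    Pi.div_apply, Rat.cast_one, Rat.cast_ofNat]
  split_ifs <;> ring

theorem val_goOn_iff : (Expr.const 1).val pb s ≤ Expr.goOn.val pb s ↔
    s.sc 5 ^ 2 ≤ (∑ i, s.ro 2 i + 1) * s.sc 10 ∧ s.sc 9 ≤ s.sc 7 := by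
  simp only [Expr.goOn, val_const, val_mul, val_le, val_add, val_sumR, vecR_var, val_var, ← sq,
    Rat.cast_one]
  split_ifs with h1 h2 h2 <;> simp [h1, h2]

/-- The invariant of the loop of the search. -/
structure SearchInv (pb : Problem d n m) (M R ε G : ℝ) (x : Fin n → ℝ) (j : ℕ) (s : Store n m) :
    Prop where
  ready : Ready M R ε G x s
  r0 : s.ro 0 = negGrad pb (rate m M R) R G x
  r1 : s.ro 1 = hess pb (rate m M R) R G x
  inv : ReweightInv pb (negGrad pb (rate m M R) R G x) (hess pb (rate m M R) R G x) (conc m M R) G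
    (Real.exp (Real.log m / 3)) j (s.ro 2) (s.sc 9) (s.sc 10) (s.pr 1) (s.pr 2)

theorem qw_pos {μ : ℝ} (hμ : 0 < μ) (hG : 0 < G) {w r : Fin m → ℝ} (hw : ∀ i, 0 ≤ w i)
    (hr : ∀ i, 0 < r i) (i : Fin m) : 0 < qw μ G w r i := by
  have := hw i; have := hr i; unfold qw; positivity

theorem exp_log_third (hm : 0 < m) : Real.exp (Real.log m / 3) ^ 3 = m := by
  rw [← Real.exp_nat_mul]
  push_cast
  rw [mul_div_cancel₀ _ (by norm_num : (3 : ℝ) ≠ 0), Real.exp_log (by exact_mod_cast hm)]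

theorem run_round (h : Admissible pb M R xs) (hS : IsLinearSolver S) (hG : 0 < G) {j : ℕ}
    (hI : SearchInv pb M R ε G x j s)
    (hg : (Expr.const 1).val pb s ≤ Expr.goOn.val pb s) :
    (j : ℝ) ≤ rounds m + Real.exp (Real.log m / 3) ∧
    Run pb S Prog.round s (SearchInv pb M R ε G x (j + 1)) 8 := by
  rw [val_goOn_iff, hI.ready.s5, hI.ready.s7] at hg
  obtain ⟨hg, hN⟩ := hg
  obtain ⟨hr, hr0, hr1, hinv⟩ := hI
  set c := Real.exp (Real.log m / 3) with hc
  set u : Fin m → ℝ := fun i => conc m M R * (G / s.sc 10 * (pb.P *ᵥ s.pr 2) i) with hu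
  have hc0 : 0 < c := Real.exp_pos _
  have hw := h.hess_nonneg hG.le x
  have hΔ' := stationary_solve pb hS (q := qw (conc m M R) G (hess pb (rate m M R) R G x)
    (reweight (3 * c) u (s.ro 2))) (qw_pos h.conc_pos hG hw fun i =>
      (hinv.r_pos i).trans_le (le_reweight (by positivity) hinv.r_pos i))
    (negGrad pb (rate m M R) R G x)
  have hstep := hinv.step h.hm hw hG h.conc_pos hc0 (exp_log_third h.hm) hg hu hΔ'
  refine ⟨hstep.1.trans (by linarith), ?_⟩
  unfold Prog.round
  refine Run.seqR (Run.seqR (Run.seqS (Run.seqP (Run.seqS (Run.seqR (Run.seqSolve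
    (Run.assignS ?_ (by norm_num))))))))
  have e3 : (Expr.up (Expr.S 4) * (Expr.up (Expr.S 5 / Expr.S 10) * .mulP (Expr.V 2))).vecR s pb
      = u := by
    funext i
    simp [hu, hr.s4, hr.s5]
  rw [e3, vecR_abs (u := u) (by simp), val_narrow (u := u) (c := c) (by simp) (by simp [hr.s6, hc]),
    vecR_reweight (u := u) (r := s.ro 2) (c := c) (by simp) (by simp [hr.s6, hc]) (by simp),
    vecR_weights (μ := conc m M R) (G := G) (w := hess pb (rate m M R) R G x)
      (r := reweight (3 * c) u (s.ro 2)) (by simp [hr.s4]) (by simp [hr.s5]) (by simp [hr1])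
      (by simp)]
  refine ⟨?_, ?_, ?_, ?_⟩
  · constructor <;> simp [hr.s0, hr.s1, hr.s2, hr.s3, hr.s4, hr.s5, hr.s6, hr.s7, hr.s8, hr.s12,
      hr.p0, hc]
  · simp [hr0]
  · simp [hr1]
  · have hX : (s.pr 1 + (fun _ => narrow (3 * c) u * (G / s.sc 10)) * s.pr 2)
        = s.pr 1 + (narrow (3 * c) u * (G / s.sc 10)) • s.pr 2 := rfl
    simpa [Expr.energy, hr0, hr.s5, hX] using hstep.2

/-- The result of the search: a better point, or a bound for the gap. -/
def Found (pb : Problem d n m) (M R G : ℝ) (xs x : Fin n → ℝ) (s : Store n m) : Prop :=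
  (s.sc 11 = 1 ∧ pb.A *ᵥ s.pr 3 = pb.b ∧
    surrogate pb (rate m M R) R G (s.pr 3) ≤ surrogate pb (rate m M R) R G x - G / 36) ∨
  (s.sc 11 = 0 ∧ ((∀ i, |(pb.P *ᵥ x) i| ≤ 2 * R) →
    surrogate pb (rate m M R) R G x - pb.objective xs ≤ ratio m M R / 2 * G))

/-- A bound for the cost of the search. -/
noncomputable def searchCost (m : ℕ) : ℝ :=
  (rounds m + Real.exp (Real.log m / 3) + 1) * (8 + 1) + 1 + 9

theorem rounds_nonneg (hm : 0 < m) : 0 ≤ rounds m := by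
  have : (1 : ℝ) ≤ m := by exact_mod_cast hm
  have : 0 ≤ Real.log (4 * m) := Real.log_nonneg (by linarith)
  unfold rounds; positivity

theorem run_search (h : Admissible pb M R xs) (hS : IsLinearSolver S) (hG : 0 < G)
    (hA : pb.A *ᵥ x = pb.b) (hs : Ready M R ε G x s) :
    Run pb S Prog.search s (fun s' => Ready M R ε G x s' ∧ Found pb M R G xs x s')
      (searchCost m) := by
  unfold Prog.search
  have hw := h.hess_nonneg hG.le x
  have hm0 : (0 : ℝ) < m := by linarith [h.one_le_m]
  refine Run.seqR (Run.seqR (Run.seqR (Run.seqS (Run.seqP (Run.seqSolve (Run.seqS ?_))))))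
  rw [hs.negGrad]
  have hs1 : Ready M R ε G x (s.setR 0 (negGrad pb (rate m M R) R G x)) := by
    constructor <;> simp [hs.s0, hs.s1, hs.s2, hs.s3, hs.s4, hs.s5, hs.s6, hs.s7, hs.s8, hs.s12,
      hs.p0]
  rw [hs1.hess]
  have e2 : (Expr.up (.const 1 / Expr.S 12)).vecR ((s.setR 0 (negGrad pb (rate m M R) R G x)).setR 1
      (hess pb (rate m M R) R G x)) pb = fun _ => 1 / (m : ℝ) := by
    funext i; simp [hs.s12]
  rw [e2, vecR_weights (μ := conc m M R) (G := G) (w := hess pb (rate m M R) R G x)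
      (r := fun _ => 1 / (m : ℝ)) (by simp [hs.s4]) (by simp [hs.s5]) (by simp) (by simp)]
  have hΔ := stationary_solve pb hS (q := qw (conc m M R) G (hess pb (rate m M R) R G x)
    (fun _ => 1 / (m : ℝ))) (qw_pos h.conc_pos hG hw fun i => by positivity)
    (negGrad pb (rate m M R) R G x)
  have hinit := ReweightInv.initial (c := Real.exp (Real.log m / 3)) h.hm hw hG hΔ
  refine Run.seq (Run.loop (B := rounds m + Real.exp (Real.log m / 3)) (c := 8)
    (I := SearchInv pb M R ε G x) (by norm_num)
    (add_nonneg (rounds_nonneg h.hm) (Real.exp_pos _).le)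
    (fun j s hI hg => run_round h hS hG hI hg) ?_) ?_
  · refine ⟨?_, ?_, ?_, ?_⟩
    · constructor <;> simp [hs.s0, hs.s1, hs.s2, hs.s3, hs.s4, hs.s5, hs.s6, hs.s7, hs.s8, hs.s12,
        hs.p0]
    · simp
    · simp
    · have hX : (fun _ => 0 : Fin n → ℝ) = 0 := rfl
      simpa [Expr.energy, hX] using hinit
  · rintro s' ⟨⟨j, hI⟩, hend⟩
    rw [val_goOn_iff, hI.ready.s5, hI.ready.s7] at hend
    obtain ⟨hr, hr0, hr1, hinv⟩ := hI
    refine Run.seqS (Run.assignP ?_ (by unfold searchCost; linarith))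
    refine ⟨?_, ?_⟩
    · constructor <;> simp [hr.s0, hr.s1, hr.s2, hr.s3, hr.s4, hr.s5, hr.s6, hr.s7, hr.s8, hr.s12,
        hr.p0]
    · by_cases hN : s'.sc 9 ≤ rounds m
      · right
        refine ⟨by simp [hr.s7, hN], fun hx => ?_⟩
        exact h.failure hG hA hx hinv fun hg => hend ⟨hg, hN⟩
      · left
        have hX : (x + (fun _ => 1 / (18 * s'.sc 9)) * s'.pr 1)
          = x + (1 / (18 * s'.sc 9)) • s'.pr 1 := rfl
        have := h.success hG (Real.exp_pos _) hA hinv (not_le.1 hN)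
        rw [← hX] at this
        refine ⟨by simp [hr.s7, hN], ?_⟩
        simpa [hr.p0] using this

end
end QSC

namespace QSC
variable {d n m : ℕ}

/-! ### The whole program -/

section
variable {pb : Problem d n m} {S : SolverMap d n} {M R ε G : ℝ} {xs x : Fin n → ℝ} {s : Store n m}

theorem run_setup (x₀ : Fin n → ℝ) :
    Run pb S Prog.setup (Store.input m M R ε x₀) (Ready M R ε ε x₀) 7 := by
  unfold Prog.setup
  refine Run.seqS (Run.seqS (Run.seqS (Run.seqS (Run.seqS (Run.seqS (Run.assignS ?_
    (by norm_num)))))))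
  have h0 : (Store.input m M R ε x₀).sc 0 = M := rfl
  have h1 : (Store.input m M R ε x₀).sc 1 = R := rfl
  have h2 : (Store.input m M R ε x₀).sc 2 = ε := rfl
  have hp : (Store.input m M R ε x₀).pr 0 = x₀ := rfl
  constructor <;> simp [h0, h1, h2, hp, rate, conc, rounds, ratio]

theorem Ready.set_scale {G' : ℝ} (h : Ready M R ε G x s) : Ready M R ε G' x (s.setS 5 G') := by
  constructor <;> simp [h.s0, h.s1, h.s2, h.s3, h.s4, h.s6, h.s7, h.s8, h.s12, h.p0]

theorem Ready.set_point {y : Fin n → ℝ} (h : Ready M R ε G x s) :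
    Ready M R ε G y (s.setP 0 y) := by
  constructor <;> simp [h.s0, h.s1, h.s2, h.s3, h.s4, h.s5, h.s6, h.s7, h.s8, h.s12]

theorem half_lt_log_two : (1 : ℝ) / 2 < Real.log 2 := by linarith [Real.log_two_gt_d9]

theorem run_raise (h : Admissible pb M R xs) (hS : IsLinearSolver S) (hε : 0 < ε)
    (hA : pb.A *ᵥ x = pb.b) (hx : ∀ i, |(pb.P *ᵥ x) i| ≤ R) (hs : Ready M R ε ε x s) :
    Run pb S Prog.raise s
      (fun s' => ∃ G, 0 < G ∧ G ≤ 144 * (2 + (pb.objective x - pb.objective xs) / ε) * ε ∧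
        Ready M R ε G x s' ∧
        surrogate pb (rate m M R) R G x - pb.objective xs ≤ ratio m M R / 2 * G)
      (searchCost m + ((2 * Real.log (72 * (2 + (pb.objective x - pb.objective xs) / ε)) + 1) *
        (1 + searchCost m + 1) + 1)) := by
  set Γ := 2 + (pb.objective x - pb.objective xs) / ε with hΓ
  have hgap : 0 ≤ (pb.objective x - pb.objective xs) / ε :=
    div_nonneg (sub_nonneg.2 (h.opt.2 x hA)) hε.le
  have hΓ2 : 2 ≤ Γ := by linarith
  have hsc : 0 ≤ searchCost m := by
    have := rounds_nonneg h.hm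
    unfold searchCost; positivity
  unfold Prog.raise
  refine Run.seq (run_search h hS hε hA hs) fun s' hs' => ?_
  refine (Run.loop (B := 2 * Real.log (72 * Γ)) (c := 1 + searchCost m)
    (I := fun j s => Ready M R ε (2 ^ j * ε) x s ∧ Found pb M R (2 ^ j * ε) xs x s ∧
      2 ^ j ≤ 144 * Γ) (by positivity)
    (mul_nonneg two_pos.le (Real.log_nonneg (by linarith))) ?_ ?_).mono ?_ (by linarith)
  · rintro j s ⟨hr, hf, hj⟩ hg
    have hG : 0 < 2 ^ j * ε := by positivity
    have hflag : s.sc 11 ≠ 0 := fun h0 => by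
      simp only [val_const, val_var, h0] at hg; norm_num at hg
    have hdec := (hf.resolve_right fun hf => hflag hf.1).2
    have h1 := h.opt.2 _ hdec.1
    have h2 := Admissible.objective_le_surrogate (pb := pb) (R := R) hG.le (rate m M R) (s.pr 3)
    have h3 := h.surrogate_le hG.le hx
    have hle : 2 ^ j * ε ≤ 72 * (pb.objective x - pb.objective xs) := by linarith [hdec.2]
    have hle' : (2 : ℝ) ^ j ≤ 72 * Γ := by
      rw [← le_div_iff₀ hε, mul_div_assoc] at hle
      linarith
    refine ⟨?_, ?_⟩
    · have := Real.log_le_log (by positivity) hle'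
      rw [Real.log_pow] at this
      have := mul_le_mul_of_nonneg_left half_lt_log_two.le (Nat.cast_nonneg (α := ℝ) j)
      linarith
    · have e : (2 : ℝ) ^ (j + 1) * ε = 2 * (2 ^ j * ε) := by ring
      refine Run.seqS ?_
      rw [e]
      have hv : (Expr.const 2 * Expr.S 5 : Expr .scal).val pb s = 2 * (2 ^ j * ε) := by
        simp [hr.s5]
      rw [hv]
      refine (run_search h hS (by positivity) hA (hr.set_scale (G' := 2 * (2 ^ j * ε)))).mono
        (fun s hs => ⟨hs.1, hs.2, ?_⟩) (by linarith)
      rw [pow_succ]; linarith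
  · exact ⟨by simpa using hs'.1, by simpa using hs'.2, by simp; linarith⟩
  · rintro s'' ⟨⟨j, hr, hf, hj⟩, hend⟩
    refine ⟨2 ^ j * ε, by positivity, by gcongr, hr, ?_⟩
    have hflag : s''.sc 11 ≠ 1 := fun h1 => hend (by simp [h1])
    exact (hf.resolve_left fun hf => hflag hf.1).2 fun i => (hx i).trans (by linarith [h.hR])

theorem run_descend (h : Admissible pb M R xs) (hS : IsLinearSolver S) (hε : 0 < ε) {Γ : ℝ}
    (hΓ : 1 ≤ Γ) (hA : pb.A *ᵥ x = pb.b) (hG : 0 < G) (hGΓ : G ≤ 144 * Γ * ε)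
    (hs : Ready M R ε G x s)
    (hgap : surrogate pb (rate m M R) R G x - pb.objective xs ≤ ratio m M R / 2 * G) :
    Run pb S Prog.descend s
      (fun s' => pb.A *ᵥ s'.pr 0 = pb.b ∧ pb.objective (s'.pr 0) - pb.objective xs ≤ ε)
      ((36 * ratio m M R + 74 * ratio m M R * Real.log (ratio m M R * (144 * Γ)) + 1) *
        (searchCost m + 2 + 1) + 1) := by
  set K := ratio m M R with hK
  have hK4 : 4 < K := h.ratio_pos
  have hsc : 0 ≤ searchCost m := by
    have := rounds_nonneg h.hm
    unfold searchCost; positivity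
  have hB : 0 ≤ Real.log (K * (144 * Γ)) := Real.log_nonneg (by nlinarith)
  unfold Prog.descend
  refine (Run.loop (B := 36 * K + 74 * K * Real.log (K * (144 * Γ))) (c := searchCost m + 2)
    (I := fun j s => ∃ G x, 0 < G ∧ pb.A *ᵥ x = pb.b ∧ Ready M R ε G x s ∧
      surrogate pb (rate m M R) R G x - pb.objective xs ≤ K * G ∧
      j + 36 * ((surrogate pb (rate m M R) R G x - pb.objective xs) / G) +
        74 * K * Real.log (K * G / ε) ≤ 36 * K + 74 * K * Real.log (K * (144 * Γ)))
    (by positivity) (by positivity) ?_ ?_).mono ?_ le_rfl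
  · rintro j s ⟨G, x, hG, hA, hr, hD, hpot⟩ hg
    have hg' : ε ≤ K * G := by simpa [hr.s2, hr.s8, hr.s5] using hg
    have hD0 : 0 ≤ (surrogate pb (rate m M R) R G x - pb.objective xs) / G :=
      div_nonneg (sub_nonneg.2 ((h.opt.2 x hA).trans
        (Admissible.objective_le_surrogate hG.le _ _))) hG.le
    have hlog : 0 ≤ Real.log (K * G / ε) := Real.log_nonneg (by rwa [one_le_div hε])
    refine ⟨by nlinarith, ?_⟩
    refine Run.seq (run_search h hS hG hA hr) fun s' hs' => ?_
    obtain ⟨hr', hf⟩ := hs'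
    refine Run.branch (fun hb => ?_) (fun hb => ?_)
    · have hflag : s'.sc 11 ≠ 0 := fun h0 => by
        simp only [val_const, val_var, h0] at hb; norm_num at hb
      obtain ⟨-, hA', hdec⟩ := hf.resolve_right fun hf => hflag hf.1
      refine Run.assignP ⟨G, s'.pr 3, hG, hA', hr'.set_point, by linarith, ?_⟩ (by linarith)
      have : (surrogate pb (rate m M R) R G (s'.pr 3) - pb.objective xs) / G
          ≤ (surrogate pb (rate m M R) R G x - pb.objective xs) / G - 1 / 36 := by
        rw [div_le_iff₀ hG, sub_mul, div_mul_cancel₀ _ hG.ne']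
        linarith
      push_cast
      linarith
    · have hflag : s'.sc 11 ≠ 1 := fun h1 => hb (by simp [h1])
      have hgap := (hf.resolve_left fun hf => hflag hf.1).2 (h.abs_le_of_surrogate hG hA hD)
      have hmono := Admissible.surrogate_mono (pb := pb) (R := R)
        (show G / 2 ≤ G by linarith) (rate m M R) x
      have hD' : surrogate pb (rate m M R) R (G / 2) x - pb.objective xs ≤ K * (G / 2) := by
        linarith
      have hv : (Expr.S 5 / Expr.const 2 : Expr .scal).val pb s' = G / 2 := by simp [hr'.s5]
      refine Run.assignS ?_ (by linarith)
      rw [hv]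
      refine ⟨G / 2, x, by positivity, hA, hr'.set_scale, hD', ?_⟩
      have h1 : (surrogate pb (rate m M R) R (G / 2) x - pb.objective xs) / (G / 2) ≤ K := by
        rwa [div_le_iff₀ (by positivity)]
      have h2 : Real.log (K * (G / 2) / ε) = Real.log (K * G / ε) - Real.log 2 := by
        rw [← Real.log_div (by positivity) (by norm_num)]
        congr 1; ring
      rw [h2]
      push_cast
      have := mul_lt_mul_of_pos_left half_lt_log_two (show 0 < 74 * K by positivity)
      linarith
  · refine ⟨G, x, hG, hA, hs, by nlinarith, ?_⟩
    have h1 : (surrogate pb (rate m M R) R G x - pb.objective xs) / G ≤ K := by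
      rw [div_le_iff₀ hG]; nlinarith
    have h2 : Real.log (K * G / ε) ≤ Real.log (K * (144 * Γ)) := by
      refine Real.log_le_log (by positivity) ?_
      rw [div_le_iff₀ hε, mul_assoc]
      exact mul_le_mul_of_nonneg_left hGΓ (by linarith)
    have := mul_le_mul_of_nonneg_left h2 (show 0 ≤ 74 * K by positivity)
    push_cast
    linarith
  · rintro s' ⟨⟨j, G, x, hG, hA, hr, hD, -⟩, hend⟩
    have hend' : K * G < ε := by simpa [hr.s2, hr.s8, hr.s5] using hend
    rw [hr.p0]
    have := Admissible.objective_le_surrogate (pb := pb) (R := R) hG.le (rate m M R) x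
    exact ⟨hA, by linarith⟩

end

/-! ### The cost -/

theorem one_le_log_two_add (hm : 0 < m) : 1 ≤ Real.log (2 + m) := by
  have : (1 : ℝ) ≤ m := by exact_mod_cast hm
  rw [Real.le_log_iff_exp_le (by linarith)]
  linarith [Real.exp_one_lt_d9]

theorem searchCost_le (hm : 0 < m) :
    searchCost m ≤ 136 * (Real.exp (Real.log m / 3) * Real.log (2 + m)) := by
  have hm1 : (1 : ℝ) ≤ m := by exact_mod_cast hm
  have hl := one_le_log_two_add hm
  set c := Real.exp (Real.log m / 3) with hc
  set l := Real.log (2 + m)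
  have hc1 : 1 ≤ c := Real.one_le_exp (by have := Real.log_nonneg hm1; positivity)
  have h4 : Real.log (4 * m) ≤ 2 * l := by
    rw [show (2 : ℝ) * l = Real.log ((2 + m) ^ 2) by rw [Real.log_pow]; norm_num [l]]
    exact Real.log_le_log (by positivity) (by nlinarith)
  have h5 := mul_le_mul_of_nonneg_left h4 (show 0 ≤ c by positivity)
  have hcl : c ≤ c * l := le_mul_of_one_le_right (by positivity) hl
  unfold searchCost rounds
  rw [← hc]
  nlinarith

theorem log_le_of_le_two_rpow {a b : ℝ} (ha : 0 < a) (h : a ≤ 2 ^ b) (hb : 0 ≤ b) : Real.log a ≤ b := by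
  have := Real.log_le_log ha h
  rw [Real.log_rpow two_pos] at this
  have h2 : Real.log 2 ≤ 1 := by linarith [Real.log_two_lt_d9]
  nlinarith

theorem ratio_le (hm : 0 < m) {M R : ℝ} (h : 0 < M * R) :
    ratio m M R ≤ 170 * ((1 + M * R) * Real.log (2 + m)) := by
  have hm1 : (1 : ℝ) ≤ m := by exact_mod_cast hm
  have hl := one_le_log_two_add hm
  set l := Real.log (2 + m)
  have h1 : rate m M R ≤ 2 * (11 + l + (1 + M * R)) := by
    rw [rate, Real.log_mul (by positivity) (by positivity), Real.log_mul (by norm_num)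
      (by positivity)]
    have a1 : Real.log 1728 ≤ 11 := log_le_of_le_two_rpow (by norm_num) (by norm_num) (by norm_num)
    have a2 : Real.log m ≤ l := Real.log_le_log (by linarith) (by linarith)
    have a3 : Real.log (2 + M * R) ≤ 1 + M * R := by
      have := Real.log_le_sub_one_of_pos (show 0 < 2 + M * R by linarith)
      linarith
    linarith
  have h2 := mul_nonneg h.le (sub_nonneg.2 hl)
  unfold ratio
  nlinarith

/-- The arithmetic of the cost bound. -/
theorem total_cost_le {a c l p g s K k L₁ L₂ : ℝ} (ha : 1 ≤ a) (hc : 1 ≤ c) (hl : 1 ≤ l)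
    (hp : 1 / 2 ≤ p) (hg : 1 / 2 ≤ g) (hs0 : 0 ≤ s) (hs : s ≤ 136 * (c * l))
    (hK0 : 1 ≤ K) (hK : K ≤ 170 * (a * l)) (hkle : k ≤ 8 + p + l)
    (hL₁ : L₁ ≤ 7 + g) (hL₂ : L₂ ≤ k + (8 + g)) :
    7 + (s + ((2 * L₁ + 1) * (1 + s + 1) + 1) +
      ((36 * K + 74 * K * L₂ + 1) * (s + 2 + 1) + 1)) ≤ 10 ^ 9 * (a * c * p * g) * l ^ 3 := by
  have hcl : 1 ≤ c * l := one_le_mul_of_one_le_of_one_le hc hl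
  have hal : 1 ≤ a * l := one_le_mul_of_one_le_of_one_le ha hl
  have hpg : 1 ≤ 4 * (p * g) := by nlinarith
  set t := p * g * l with ht
  have ht1 : 1 ≤ 4 * t := by
    have : 4 * t = 4 * (p * g) * l := by rw [ht]; ring
    rw [this]; exact one_le_mul_of_one_le_of_one_le hpg hl
  have hpt : p ≤ 2 * t := by
    have : 0 ≤ p * (2 * (g * l) - 1) := mul_nonneg (by linarith) (by nlinarith)
    rw [ht]; linarith
  have hgt : g ≤ 2 * t := by
    have : 0 ≤ g * (2 * (p * l) - 1) := mul_nonneg (by linarith) (by nlinarith)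
    rw [ht]; linarith
  have hlt : l ≤ 4 * t := by
    have : 0 ≤ l * (4 * (p * g) - 1) := mul_nonneg (by linarith) (by linarith)
    rw [ht]; linarith
  have h1 : 2 * L₁ + 1 ≤ 64 * t := by linarith
  have h2 : 36 * K + 74 * K * L₂ + 1 ≤ K * (5500 * t) := by
    have : L₂ ≤ 72 * t := by linarith
    have : 74 * K * L₂ ≤ 74 * K * (72 * t) := mul_le_mul_of_nonneg_left this (by linarith)
    have : 37 * K ≤ K * (37 * (4 * t)) := by
      have := mul_le_mul_of_nonneg_left ht1 (show 0 ≤ 37 * K by linarith)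
      linarith
    have := mul_nonneg (show 0 ≤ K by linarith) (show 0 ≤ t by linarith)
    linarith
  have h3 : K * (5500 * t) ≤ 935000 * (a * l * t) := by
    have := mul_le_mul_of_nonneg_right hK (show 0 ≤ 5500 * t by linarith)
    linarith
  have hs3 : s + 2 + 1 ≤ 139 * (c * l) := by linarith
  have ht0 : 0 ≤ t := by linarith
  have hT : 0 ≤ a * l * t := mul_nonneg (by linarith) ht0
  have h4 : (36 * K + 74 * K * L₂ + 1) * (s + 2 + 1) ≤ 935000 * (a * l * t) * (139 * (c * l)) :=
    mul_le_mul (h2.trans h3) hs3 (by linarith) (by linarith)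
  have htal : t ≤ a * l * t := le_mul_of_one_le_left ht0 hal
  have h5 : (2 * L₁ + 1) * (1 + s + 1) ≤ 64 * (a * l * t) * (139 * (c * l)) :=
    mul_le_mul (by linarith) (by linarith) (by linarith) (by linarith)
  have hU : c * l ≤ 4 * (a * l * t * (c * l)) := by
    have : 0 ≤ (c * l) * (4 * (a * l * t) - 1) := mul_nonneg (by linarith) (by linarith)
    linarith
  have e : a * c * p * g * l ^ 3 = a * l * t * (c * l) := by rw [ht]; ring
  have e' : 10 ^ 9 * (a * c * p * g) * l ^ 3 = 10 ^ 9 * (a * c * p * g * l ^ 3) := by ring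
  rw [e', e]
  linarith

end QSC

open QSC
theorem mainTheorem1 :
    ∃ (prog : QSC.Prog) (C : ℝ) (k : ℕ),
      ∀ (d n m : ℕ) (_ : 0 < m) (pb : QSC.Problem d n m) (M R ε : ℝ)
        (_ : QSC.IsQuasiSelfConcordant pb.f M) (_ : 0 < R) (_ : 0 < ε)
        (xstar : Fin n → ℝ) (_ : pb.IsOptimal xstar) (_ : ‖pb.P *ᵥ xstar‖ ≤ R)
        (x₀ : Fin n → ℝ) (_ : pb.A *ᵥ x₀ = pb.b) (_ : ‖pb.P *ᵥ x₀‖ ≤ R)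
        (S : QSC.SolverMap d n) (_ : QSC.IsLinearSolver S),
        ∃ (s : QSC.Store n m) (solves steps : ℕ),
          QSC.Exec pb S prog (QSC.Store.input m M R ε x₀) s solves steps ∧
          pb.A *ᵥ s.output = pb.b ∧
          pb.objective s.output - pb.objective xstar ≤ ε ∧
          ((max solves steps : ℕ) : ℝ) ≤
            C * ((1 + M * R) * (m : ℝ) ^ (1 / 3 : ℝ) * Real.log (2 + M * R) *
              Real.log (2 + (pb.objective x₀ - pb.objective xstar) / ε)) *
              Real.log (2 + m) ^ k := by
  refine ⟨Prog.main, 10 ^ 9, 3, ?_⟩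
  intro d n m hm pb M R ε hf hR hε xs hopt hxs x₀ hA hx₀ S hS
  have hsup : ∀ {y : Fin n → ℝ}, ‖pb.P *ᵥ y‖ ≤ R → ∀ i, |(pb.P *ᵥ y) i| ≤ R := fun hy i =>
    (norm_le_pi_norm (pb.P *ᵥ _) i).trans hy
  have h : Admissible pb M R xs := ⟨hm, hf, hR, hopt, hsup hxs⟩
  have hgap : 0 ≤ (pb.objective x₀ - pb.objective xs) / ε :=
    div_nonneg (sub_nonneg.2 (hopt.2 x₀ hA)) hε.le
  set Γ := 2 + (pb.objective x₀ - pb.objective xs) / ε with hΓ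
  have hrun : Run pb S Prog.main (Store.input m M R ε x₀)
      (fun s' => pb.A *ᵥ s'.pr 0 = pb.b ∧ pb.objective (s'.pr 0) - pb.objective xs ≤ ε)
      (7 + (searchCost m + ((2 * Real.log (72 * Γ) + 1) * (1 + searchCost m + 1) + 1) +
        ((36 * ratio m M R + 74 * ratio m M R * Real.log (ratio m M R * (144 * Γ)) + 1) *
          (searchCost m + 2 + 1) + 1))) := by
    refine Run.seq (run_setup x₀) fun s hs => ?_
    refine Run.seq (run_raise h hS hε hA (hsup hx₀) hs) ?_
    rintro s' ⟨G, hG, hGΓ, hs', hD⟩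
    exact (run_descend h hS hε (by linarith) hA hG hGΓ hs' hD).mono (fun _ h => h)
      (by rw [← hΓ]; linarith)
  obtain ⟨s, solves, steps, hex, ⟨hAs, hobj⟩, hk, hl⟩ := hrun
  refine ⟨s, solves, steps, hex, hAs, hobj, ?_⟩
  have hm1 : (1 : ℝ) ≤ m := by exact_mod_cast hm
  have hMR := h.mr_pos
  have hl1 := one_le_log_two_add hm
  have hK4 := h.ratio_pos
  have hK := ratio_le hm hMR
  have hΓ2 : 2 ≤ Γ := by linarith
  have hlog2 : ∀ {y : ℝ}, 2 ≤ y → 1 / 2 ≤ Real.log y := fun hy =>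
    half_lt_log_two.le.trans (Real.log_le_log two_pos hy)
  have hc : (m : ℝ) ^ (1 / 3 : ℝ) = Real.exp (Real.log m / 3) := by
    rw [Real.rpow_def_of_pos (by linarith)]; ring_nf
  have hsc : 0 ≤ searchCost m := by
    have := rounds_nonneg hm
    unfold searchCost; positivity
  have hkle : Real.log (ratio m M R) ≤ 8 + Real.log (2 + M * R) + Real.log (2 + m) := by
    have h1 := Real.log_le_log (by linarith) hK
    rw [Real.log_mul (by norm_num) (by positivity), Real.log_mul (by positivity) (by positivity)]
      at h1
    have a1 : Real.log 170 ≤ 8 := log_le_of_le_two_rpow (by norm_num) (by norm_num) (by norm_num)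
    have a2 : Real.log (1 + M * R) ≤ Real.log (2 + M * R) :=
      Real.log_le_log (by linarith) (by linarith)
    have a3 := Real.log_le_sub_one_of_pos (show 0 < Real.log (2 + (m : ℝ)) by linarith)
    linarith
  have hL₁ : Real.log (72 * Γ) ≤ 7 + Real.log Γ := by
    rw [Real.log_mul (by norm_num) (by positivity)]
    have : Real.log 72 ≤ 7 := log_le_of_le_two_rpow (by norm_num) (by norm_num) (by norm_num)
    linarith
  have hL₂ : Real.log (ratio m M R * (144 * Γ)) ≤ Real.log (ratio m M R) + (8 + Real.log Γ) := by
    rw [Real.log_mul (by linarith) (by positivity), Real.log_mul (by norm_num) (by positivity)]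
    have : Real.log 144 ≤ 8 := log_le_of_le_two_rpow (by norm_num) (by norm_num) (by norm_num)
    linarith
  have hcost := total_cost_le (a := 1 + M * R) (c := (m : ℝ) ^ (1 / 3 : ℝ)) (by linarith)
    (Real.one_le_rpow hm1 (by norm_num)) hl1 (hlog2 (show 2 ≤ 2 + M * R by linarith))
    (hlog2 hΓ2) hsc (by rw [hc]; exact searchCost_le hm) (by linarith) hK hkle hL₁ hL₂
  rcases max_choice solves steps with e | e <;> rw [e]
  · exact hk.trans hcost
  · exact hl.trans hcost
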